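/- Let $f$ be a field of characteristic $0$. Let $W_1$ be the Lie algebra of $f$-derivations of the power series algebra $f[[t]]$, put $l_i=t^{i+1}\frac{d}{dt}$, so that $[l_i,l_j]=(j-i)l_{i+j}$, and for $p\ge 0$ let $L_p\subset W_1$ be the Lie subalgebra of all $\sum_{i\ge p}a_il_i$, $a_i\in f$. For $0\le p\le q$, $L_q$ is an ideal of $L_p$; let $L_{p,q}=L_p/L_q$ and let $U_{p,q}$ be the universal enveloping algebra of $L_{p,q}$. The image of $l_i$ in $U_{p,q}$ is again denoted by $l_i$. Let $m\ge 0$ and $n\geq m$. (a) If $n\le 2m+2$, then $U_{m+1,n+1}$ is commutative. (b) If $n\ge 2m+2$ and $n$ is odd, then the center of $U_{m+1,n+1}$ is the polynomial algebra $f[l_n,l_{n-1},\dots,l_{n-m}]$, i.e. it is generated by $l_n,\dots,l_{n-m}$, which are algebraically independent over $f$. (c) There are polynomials $P_{mk}\in f[x_0,\dots,x_{m+k}]$, $k\ge 1$, with the generating function $$\sum_{k=1}^{\infty}P_{mk}(x_0,x_1,\dots,x_{m+k})z^k=\frac{\sqrt{\sum_{k=0}^{\infty}x_kx_0^{k-1}z^k}-\sqrt{\sum_{k=0}^{m}x_kx_0^{k-1}z^k}}{x_0^mz^m},$$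 where the series under both roots have constant term $1$, and $\sqrt{\ }$ denotes the square root with constant term $1$. If $n\ge 2m+2$ and $n$ is even, then, with $k=n/2-m$, the center of $U_{m+1,n+1}$ is the polynomial algebra $f[l_n,l_{n-1},\dots,l_{n-m},P_{mk}(l_n,l_{n-1},\dots,l_{n/2})]$, i.e. it is generated by these $m+2$ elements, which are algebraically independent over $f$. (The elements $l_n,l_{n-1},\dots,l_{n/2}$ commute with one another, so the value of $P_{mk}$ at them is defined.) -/

import Mathlib

open scoped PowerSeries

noncomputable section

namespace WittType

variable (f : Type*) [Field f]

/-- `W_1`: the Lie algebra of `f`-derivations of `f[[t]]` (with the commutator bracket). A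
derivation `D` is determined by `D t = ∑ a_i t^{i+1}`, that is `D = ∑_{i ≥ -1} a_i l_i`. -/
abbrev W : Type _ := Derivation f f⟦X⟧ f⟦X⟧

variable {f}

theorem X_pow_dvd_apply {n : ℕ} {D : W f} (hD : (PowerSeries.X : f⟦X⟧) ^ n ∣ D PowerSeries.X)
    (g : f⟦X⟧) : (PowerSeries.X : f⟦X⟧) ^ n ∣ D g := by
  have key : ∀ j, j ≤ n → ∀ g : f⟦X⟧, (PowerSeries.X : f⟦X⟧) ^ j ∣ D g := by
    intro j
    induction j with
    | zero => intro _ g; simp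
    | succ j ih =>
      intro hj g
      obtain ⟨h, hh⟩ : (PowerSeries.X : f⟦X⟧) ∣ g - PowerSeries.C (PowerSeries.constantCoeff g) := by
        rw [PowerSeries.X_dvd_iff]; simp
      have hg : g = algebraMap f f⟦X⟧ (PowerSeries.constantCoeff g) + PowerSeries.X * h := by
        rw [← hh]; simp
      rw [hg, map_add, Derivation.map_algebraMap, zero_add, Derivation.leibniz, smul_eq_mul,
        smul_eq_mul]
      refine dvd_add ?_ (dvd_mul_of_dvd_right ((pow_dvd_pow _ hj).trans hD) _)
      rw [pow_succ']
      exact mul_dvd_mul_left _ (ih (by omega) h)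
  exact key n le_rfl g

theorem X_pow_dvd_lie {n : ℕ} {D E : W f} (hD : (PowerSeries.X : f⟦X⟧) ∣ D PowerSeries.X)
    (hE : (PowerSeries.X : f⟦X⟧) ^ (n + 1) ∣ E PowerSeries.X) :
    (PowerSeries.X : f⟦X⟧) ^ (n + 1) ∣ ⁅D, E⁆ PowerSeries.X := by
  rw [Derivation.commutator_apply]
  refine dvd_sub ?_ (X_pow_dvd_apply hE _)
  obtain ⟨h, hh⟩ := hE
  obtain ⟨d, hd⟩ := hD
  rw [hh, Derivation.leibniz, Derivation.leibniz_pow, hd]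
  simp only [smul_eq_mul, nsmul_eq_mul, Nat.add_sub_cancel]
  exact ⟨D h + h * ((n + 1 : ℕ) * d), by ring⟩

variable (f)

/-- `L_n ⊆ W_1` for `n ≥ 0`: the Lie subalgebra of the derivations `∑ a_i l_i` with `a_i = 0` for
`i < n`; as `D t = ∑ a_i t^{i+1}`, this says that `t^{n+1}` divides `D t`. -/
def L (n : ℕ) : LieSubalgebra f (W f) where
  carrier := {D | (PowerSeries.X : f⟦X⟧) ^ (n + 1) ∣ D PowerSeries.X}
  add_mem' := fun ha hb => dvd_add ha hb
  zero_mem' := dvd_zero _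
  smul_mem' := fun c D hD => by
    change _ ∣ (c • D) PowerSeries.X
    rw [Derivation.smul_apply, PowerSeries.smul_eq_C_mul]
    exact dvd_mul_of_dvd_right hD _
  lie_mem' := fun {D E} hD hE => X_pow_dvd_lie ((dvd_pow_self _ n.succ_ne_zero).trans hD) hE

/-- `L_n` as an ideal of `L_m` (for `m ≤ n`; in general this is `L_m ∩ L_n`). -/
def LIdeal (m n : ℕ) : LieIdeal f (L f m) where
  carrier := {D | (D : W f) ∈ L f n}
  add_mem' := fun ha hb => (L f n).add_mem ha hb
  zero_mem' := (L f n).zero_mem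
  smul_mem' := fun c _ hD => (L f n).smul_mem c hD
  lie_mem := fun {D _} hE =>
    X_pow_dvd_lie ((dvd_pow_self _ m.succ_ne_zero).trans D.2) hE

/-- The Lie algebra `L_{mn} = L_m / L_n`. -/
abbrev LQuot (m n : ℕ) : Type _ := L f m ⧸ LIdeal f m n

/-- The universal enveloping algebra `U_{mn}` of `L_{mn}`. -/
abbrev U (m n : ℕ) : Type _ := UniversalEnvelopingAlgebra f (LQuot f m n)

/-- The vector field `l_i = t^{i+1} d/dt`, for `i ≥ 0`. -/
def vectorField (i : ℕ) : W f := (PowerSeries.X : f⟦X⟧) ^ (i + 1) • PowerSeries.derivative f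

theorem vectorField_mem {m i : ℕ} (h : m ≤ i) : vectorField f i ∈ L f m := by
  change _ ∣ (vectorField f i) PowerSeries.X
  rw [vectorField, Derivation.smul_apply, PowerSeries.derivative_X, smul_eq_mul, mul_one]
  exact pow_dvd_pow _ (by omega)

/-- The element `l_i` of `L_m`, for `i ≥ m`. -/
def lSub {m i : ℕ} (h : m ≤ i) : L f m := ⟨vectorField f i, vectorField_mem f h⟩

/-- The element `l_i` of `U_{mn}`, for `i ≥ m`: the image of the class `l_i + L_n ∈ L_{mn}`. -/
def l (m n : ℕ) {i : ℕ} (h : m ≤ i) : U f m n :=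
  UniversalEnvelopingAlgebra.ι f (LieSubmodule.Quotient.mk (N := LIdeal f m n) (lSub f h))

variable {f}

/-- The value `P(a_0, …, a_{N-1})` of a polynomial `P` at elements of an associative algebra. The
factors of each monomial are multiplied in the order of their indices, which is irrelevant for
pairwise commuting `a_i`, the only case in which this is used. -/
def evalAt {A : Type*} [Ring A] [Algebra f A] {N : ℕ} (a : Fin N → A)
    (P : MvPolynomial (Fin N) f) : A :=
  ∑ s ∈ P.support, P.coeff s • (List.ofFn fun i => a i ^ s i).prod

variable (f)

/-- The center of the algebra `A` is the polynomial algebra `f[x_j : j ∈ J]`: the elements `x_j` are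
central, they are algebraically independent over `f`, and they generate the center. -/
def CenterIsPolynomialAlgebra {A : Type*} [Ring A] [Algebra f A] {J : Type*} (x : J → A) : Prop :=
  (∃ hx : ∀ j, x j ∈ Subalgebra.center f A,
    AlgebraicIndependent f fun j => (⟨x j, hx j⟩ : Subalgebra.center f A)) ∧
  Subalgebra.center f A = Algebra.adjoin f (Set.range x)

/-- The field `f(x_0, x_1, x_2, …)` of rational functions. -/
abbrev RatFun : Type _ := FractionRing (MvPolynomial ℕ f)

/-- The variable `x_i` in `f(x_0, x_1, x_2, …)`. -/
def x (i : ℕ) : RatFun f := algebraMap (MvPolynomial ℕ f) (RatFun f) (MvPolynomial.X i)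

/-- The power series `∑_{k ≥ 0} x_k x_0^{k-1} z^k` (its constant term is `x_0 x_0^{-1} = 1`). -/
def fullSeries : (RatFun f)⟦X⟧ := PowerSeries.mk fun k => x f k * x f 0 ^ ((k : ℤ) - 1)

/-- The polynomial `∑_{k = 0}^m x_k x_0^{k-1} z^k` in `z`, as a power series. -/
def partialSeries (m : ℕ) : (RatFun f)⟦X⟧ :=
  PowerSeries.mk fun k => if k ≤ m then x f k * x f 0 ^ ((k : ℤ) - 1) else 0

variable {f}

/-- `s = √g`, for a power series `g` with constant term `1`: the square root of `g` with constant
term `1` (there is at most one over a field of characteristic zero). -/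
def IsSqrt {K : Type*} [Field K] (s g : K⟦X⟧) : Prop :=
  PowerSeries.constantCoeff s = 1 ∧ s ^ 2 = g

/-- The polynomials `P_k = P_{mk}(x_0, …, x_{m+k})`, `k ≥ 1`, have the generating function
`∑_{k ≥ 1} P_k z^k = (√(∑_{k ≥ 0} x_k x_0^{k-1} z^k) - √(∑_{k = 0}^m x_k x_0^{k-1} z^k)) / (x_0^m z^m)`.
The denominator, which is not a zero divisor, is cleared. -/
def HasGeneratingFunction (m : ℕ) (P : (k : ℕ) → MvPolynomial (Fin (m + k + 1)) f) : Prop :=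
  ∃ s r : (RatFun f)⟦X⟧, IsSqrt s (fullSeries f) ∧ IsSqrt r (partialSeries f m) ∧
    PowerSeries.C (x f 0 ^ m) * PowerSeries.X ^ m *
      (PowerSeries.mk fun k => if k = 0 then 0 else
        algebraMap (MvPolynomial ℕ f) (RatFun f) (MvPolynomial.rename Fin.val (P k))) = s - r

end WittType

end

/-! Put `y_j = l_{n-j}` for `j < N = n - m`. Then `[y_i, y_j] = (i - j) y_{i+j-n}`, read as `0` when
`i + j < n`. Hence `y_0, …, y_m` are central, and for `n ≤ 2m+2` all the generators commute. The
ordered monomials in the `y_j` form a basis (Poincaré–Birkhoff–Witt): they span by reordering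
(`WittRelations.exists_orderedEval_eq`), and they are independent because `U` acts on a polynomial
ring with `y_j` acting as multiplication by `x_j` plus a derivation that does not raise degree
(`eq_zero_of_orderedEval_eq_zero`). So a central element is an ordered value of a unique polynomial
`g`.

If `x_q` is the last variable that may occur in `g` and `q > m`, then `y_{n-q}` commutes with every
`y_j`, `j < q`, and `[y_{n-q}, y_q] = (n - 2q) y_0`; the commutator with `g` is therefore `(n - 2q)
y_0 ∂g/∂x_q`. This eliminates `x_q` unless `n = 2q`. For odd `n` only `x_0, …, x_m` survive.

For `n = 2h`, `h = m + k`, the descent stops at `x_h`. The elements `y_0, …, y_h` commute, and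
`y_{h+i}` acts on polynomials in them by the derivation `D_i = ∑_{p ≤ i} (2i - p) x_p ∂/∂x_{h-i+p}`.
It remains to find the common kernel of `D_1, …, D_{k-1}` in `f[x_0, …, x_h]`. That `P_{mk}` lies in
it is a coefficient identity for `s = √F`, `F = 1 + ∑ x_k x_0^{k-1} z^k`: from `2 ∂s/∂x_j =
x_0^{j-1} z^j / s` the claim becomes a consequence of `F/s = s` and `zF'/s = 2zs'`. Conversely, the
`D_i` are triangular, so a kernel element free of `x_h` lies in `B = f[x_0, …, x_m]`. As `2
∂P_{mk}/∂x_h = x_0^{k-1}`, integration in `x_h` shows that `x_0^{k-1} g` is in `B[P_{mk}]` for each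
kernel element `g`. The powers of `x_0` can be cancelled because `x_0` does not divide
`∂P_{mk}/∂x_{m+1}` (`exists_aeval_eq_of_shiftDerivation_eq_zero`). -/

open scoped PowerSeries

noncomputable section

namespace WittType

/-! ### Square roots of power series and where their coefficients lie -/

section PowerSeriesLemmas

variable {R : Type*} [CommRing R]

/-- The root is the binomial series `(1 + X)^{1/2}` with `F - 1` substituted for `X`. -/
theorem exists_sq_eq_of_constantCoeff_eq_one [Algebra ℚ R] (F : R⟦X⟧)
    (hF : PowerSeries.constantCoeff F = 1) :
    ∃ s : R⟦X⟧, PowerSeries.constantCoeff s = 1 ∧ s ^ 2 = F := by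
  have hs : PowerSeries.HasSubst (F - 1) :=
    PowerSeries.HasSubst.of_constantCoeff_zero' (by simp [hF])
  refine ⟨(PowerSeries.binomialSeries R (1 / 2 : ℚ)).subst (F - 1), ?_, ?_⟩
  · refine (PowerSeries.constantCoeff_subst hs _).trans ((finsum_eq_single _ 0 ?_).trans ?_)
    · intro n hn
      have : MvPowerSeries.constantCoeff (F - 1) = 0 := by
        change PowerSeries.constantCoeff (F - 1) = 0
        simp [hF]
      rw [map_pow, this, zero_pow hn, smul_zero]
    · simp
  · rw [sq, ← PowerSeries.subst_mul hs, ← PowerSeries.binomialSeries_add]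
    have : (1 / 2 + 1 / 2 : ℚ) = ((1 : ℕ) : ℚ) := by norm_num
    rw [this, PowerSeries.binomialSeries_nat, pow_one, PowerSeries.subst_add hs,
      PowerSeries.subst_X hs]
    have : PowerSeries.subst (F - 1) (1 : R⟦X⟧) = 1 := by
      rw [← PowerSeries.coe_substAlgHom hs, map_one]
    rw [this]; ring

/-- The power series whose `k`-th coefficient lies in the `k`-th member of a monotone family of
subalgebras. -/
def filteredSeries {f : Type*} [CommRing f] [Algebra f R] (S : ℕ → Subalgebra f R)
    (hS : Monotone S) : Subring R⟦X⟧ where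
  carrier := {g | ∀ a, PowerSeries.coeff a g ∈ S a}
  mul_mem' := fun {g h} hg hh a => by
    rw [PowerSeries.coeff_mul]
    exact sum_mem fun p hp => mul_mem (hS (by have := Finset.HasAntidiagonal.mem_antidiagonal.mp hp; omega) (hg _))
      (hS (by have := Finset.HasAntidiagonal.mem_antidiagonal.mp hp; omega) (hh _))
  one_mem' := fun a => by
    rw [PowerSeries.coeff_one]; split_ifs
    exacts [one_mem _, zero_mem _]
  add_mem' := fun hg hh a => by rw [map_add]; exact add_mem (hg a) (hh a)
  zero_mem' := fun a => by rw [map_zero]; exact zero_mem _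
  neg_mem' := fun hg a => by rw [map_neg]; exact neg_mem (hg a)

variable {f : Type*} [Field f] [Algebra f R] {S : ℕ → Subalgebra f R}
  {hS : Monotone S}

theorem mem_of_two_mul_mem [CharZero f] {T : Subalgebra f R} {a : R} (h : 2 * a ∈ T) : a ∈ T := by
  have := T.smul_mem h (2⁻¹ : f)
  rwa [two_mul, ← two_smul f a, smul_smul,
    inv_mul_cancel₀ two_ne_zero, one_smul] at this

/-- The coefficient of `z^a` in `v * p` is twice that of `p` plus products involving earlier
coefficients of `p`, so the coefficients of `p` are found recursively, dividing only by `2`. The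
next lemma is the same recursion for `s * s`. -/
theorem mem_filteredSeries_of_mul_eq [CharZero f] {g v p : R⟦X⟧} (hg : g ∈ filteredSeries S hS)
    (hv : v ∈ filteredSeries S hS) (hc : PowerSeries.constantCoeff v = 2) (h : v * p = g) :
    p ∈ filteredSeries S hS := by
  intro a
  induction a using Nat.strong_induction_on with
  | _ a ih =>
    have := hg a
    rw [← h, PowerSeries.coeff_mul, Finset.Nat.sum_antidiagonal_eq_sum_range_succ_mk,
      Finset.sum_range_succ', Nat.sub_zero, PowerSeries.coeff_zero_eq_constantCoeff_apply,
      hc] at this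
    refine mem_of_two_mul_mem (f := f) ((add_mem_cancel_left ?_).mp this)
    refine sum_mem fun i hi => ?_
    rw [Finset.mem_range] at hi
    exact mul_mem (hS (by omega) (hv _)) (hS (by omega) (ih _ (by omega)))

theorem mem_filteredSeries_of_sq_mem [CharZero f] {s : R⟦X⟧} (hc : PowerSeries.constantCoeff s = 1)
    (h : s ^ 2 ∈ filteredSeries S hS) : s ∈ filteredSeries S hS := by
  intro a
  induction a using Nat.strong_induction_on with
  | _ a ih =>
    rcases a with _ | a
    · rw [PowerSeries.coeff_zero_eq_constantCoeff_apply, hc]; exact one_mem _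
    have := h (a + 1)
    rw [sq, PowerSeries.coeff_mul, Finset.Nat.sum_antidiagonal_eq_sum_range_succ_mk,
      Finset.sum_range_succ, Finset.sum_range_succ', Nat.sub_zero, Nat.sub_self,
      PowerSeries.coeff_zero_eq_constantCoeff_apply, hc, one_mul, mul_one, add_assoc,
      ← two_mul] at this
    refine mem_of_two_mul_mem (f := f) ((add_mem_cancel_left ?_).mp this)
    refine sum_mem fun i hi => ?_
    rw [Finset.mem_range] at hi
    exact mul_mem (hS (by omega) (ih _ (by omega))) (hS (by omega) (ih _ (by omega)))

/-- A derivation of `R` applied to the coefficients of a power series. -/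
def coeffwise (D : Derivation f R R) (g : R⟦X⟧) : R⟦X⟧ :=
  PowerSeries.mk fun a => D (PowerSeries.coeff a g)

theorem coeffwise_mul (D : Derivation f R R) (g h : R⟦X⟧) :
    coeffwise D (g * h) = g * coeffwise D h + h * coeffwise D g := by
  ext a
  rw [mul_comm h]
  simp only [coeffwise, PowerSeries.coeff_mk, PowerSeries.coeff_mul, map_sum, map_add,
    Derivation.leibniz, smul_eq_mul, Finset.sum_add_distrib]
  congr 1
  exact Finset.sum_congr rfl fun _ _ => mul_comm _ _

/-- Here `t = (1 + X)^{-1/2}`. Its differential equation `2t'(1 + X) + t = 0` gives the recursion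
`2(a+1) t_{a+1} = -(2a+1) t_a`, whose factors do not vanish in characteristic zero. -/
theorem coeff_ne_zero_of_sq_mul_one_add_X {K : Type*} [Field K] [CharZero K] {t : K⟦X⟧}
    (hc : PowerSeries.constantCoeff t = 1) (h : t ^ 2 * (1 + PowerSeries.X) = 1) (a : ℕ) :
    PowerSeries.coeff a t ≠ 0 := by
  have hd : 2 * PowerSeries.derivative K t * (1 + PowerSeries.X) + t = 0 := by
    have := congrArg (PowerSeries.derivative K) h
    simp only [Derivation.leibniz, sq, smul_eq_mul, map_add, PowerSeries.derivative_X,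
      Derivation.map_one_eq_zero] at this
    have ht : t ≠ 0 := by rintro rfl; simp at hc
    refine (mul_eq_zero.mp (?_ : t * _ = 0)).resolve_left ht
    linear_combination this
  induction a with
  | zero => simp [hc]
  | succ a ih =>
    have := congrArg (PowerSeries.coeff a) hd
    have h2 : PowerSeries.coeff a (PowerSeries.X * PowerSeries.derivative K t) =
        a * PowerSeries.coeff a t := by
      cases a with
      | zero => simp
      | succ b => rw [PowerSeries.coeff_succ_X_mul, PowerSeries.coeff_derivative]; push_cast; ring
    have h3 : 2 * PowerSeries.derivative K t * (1 + PowerSeries.X) + t =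
        (2 : K) • PowerSeries.derivative K t +
          (2 : K) • (PowerSeries.X * PowerSeries.derivative K t) + t := by
      rw [two_smul, two_smul]; ring
    rw [h3] at this
    simp only [map_add, map_smul, h2, PowerSeries.coeff_derivative, map_zero, smul_eq_mul] at this
    intro h0
    rw [h0] at this
    have h4 : (2 * a + 1 : K) * PowerSeries.coeff a t = 0 := by linear_combination this
    rcases mul_eq_zero.mp h4 with h5 | h5
    · exact absurd h5 (by exact_mod_cast (by omega : 2 * a + 1 ≠ 0))
    · exact ih h5

end PowerSeriesLemmas

/-! ### The series under the roots, with polynomial coefficients -/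

open MvPolynomial in
/-- The power series `1 + ∑_{k ≥ 1} x_k x_0^{k-1} z^k` over `f[x_0, x_1, …]`. -/
def integralSeries (f : Type*) [Field f] : (MvPolynomial ℕ f)⟦X⟧ :=
  PowerSeries.mk fun k => if k = 0 then 1 else X k * X 0 ^ (k - 1)

open MvPolynomial in
/-- The truncation of `integralSeries` after the power `z^m`. -/
def integralPartialSeries (f : Type*) [Field f] (m : ℕ) : (MvPolynomial ℕ f)⟦X⟧ :=
  PowerSeries.mk fun k => if k = 0 then 1 else if k ≤ m then X k * X 0 ^ (k - 1) else 0

open MvPolynomial in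
/-- The power series `∑_{k ≥ 1} x_{m+k} x_0^{k-1} z^k`. -/
def tailSeries (f : Type*) [Field f] (m : ℕ) : (MvPolynomial ℕ f)⟦X⟧ :=
  PowerSeries.mk fun k => if k = 0 then 0 else X (m + k) * X 0 ^ (k - 1)

variable {f : Type*} [Field f]

/-- With `s` and `r` the two roots, the left side is `(s - r)(s + r)`. Since `s + r` is a unit, this
is what makes `s - r` divisible by `x_0^m z^m`. -/
theorem integralSeries_sub_integralPartialSeries (m : ℕ) :
    integralSeries f - integralPartialSeries f m =
      PowerSeries.C (MvPolynomial.X 0 ^ m) * PowerSeries.X ^ m * tailSeries f m := by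
  ext1 a
  rw [mul_assoc, PowerSeries.coeff_C_mul, PowerSeries.coeff_X_pow_mul', map_sub]
  simp only [integralSeries, integralPartialSeries, tailSeries, PowerSeries.coeff_mk]
  rcases Nat.eq_zero_or_pos a with rfl | ha
  · simp
  rcases le_or_gt a m with h | h
  · rcases h.eq_or_lt with rfl | h'
    · simp [ha.ne']
    · simp [ha.ne', h, not_le.mpr h']
  · rw [if_neg ha.ne', if_neg ha.ne', if_neg h.not_ge, if_pos h.le, if_neg (by omega), sub_zero,
      show m + (a - m) = a by omega, mul_left_comm, ← pow_add,
      show m + (a - m - 1) = a - 1 by omega]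

/-- The subalgebras `f[x_0, …, x_{m+a}]`. -/
abbrev initialVars (f : Type*) [Field f] (m a : ℕ) : Subalgebra f (MvPolynomial ℕ f) :=
  MvPolynomial.supported f {j | j ≤ m + a}

theorem initialVars_mono (m : ℕ) : Monotone (initialVars f m) := fun _ _ h =>
  MvPolynomial.supported_mono fun _ hj => le_trans (Set.mem_ofPred.mp hj) (by omega)

theorem X_mem_initialVars {m a j : ℕ} (h : j ≤ m + a) :
    (MvPolynomial.X j : MvPolynomial ℕ f) ∈ initialVars f m a :=
  MvPolynomial.X_mem_supported.mpr h

theorem integralSeries_mem (m : ℕ) :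
    integralSeries f ∈ filteredSeries (initialVars f m) (initialVars_mono m) := by
  intro a
  rw [integralSeries, PowerSeries.coeff_mk]
  split_ifs
  · exact one_mem _
  · exact mul_mem (X_mem_initialVars (by omega)) (pow_mem (X_mem_initialVars (by omega)) _)

theorem integralPartialSeries_mem (m : ℕ) :
    integralPartialSeries f m ∈ filteredSeries (initialVars f m) (initialVars_mono m) := by
  intro a
  rw [integralPartialSeries, PowerSeries.coeff_mk]
  split_ifs
  · exact one_mem _
  · exact mul_mem (X_mem_initialVars (by omega)) (pow_mem (X_mem_initialVars (by omega)) _)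
  · exact zero_mem _

theorem tailSeries_mem (m : ℕ) :
    tailSeries f m ∈ filteredSeries (initialVars f m) (initialVars_mono m) := by
  intro a
  rw [tailSeries, PowerSeries.coeff_mk]
  split_ifs
  · exact zero_mem _
  · exact mul_mem (X_mem_initialVars (by omega)) (pow_mem (X_mem_initialVars (by omega)) _)

theorem pderiv_X_zero_pow {j : ℕ} (hj : j ≠ 0) (a : ℕ) :
    MvPolynomial.pderiv j ((MvPolynomial.X 0 : MvPolynomial ℕ f) ^ a) = 0 := by
  rw [MvPolynomial.pderiv_pow, MvPolynomial.pderiv_X_of_ne hj.symm, mul_zero]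

theorem coeffwise_pderiv_integralSeries {j : ℕ} (hj : j ≠ 0) :
    coeffwise (MvPolynomial.pderiv j) (integralSeries f) =
      PowerSeries.C (MvPolynomial.X 0 ^ (j - 1)) * PowerSeries.X ^ j := by
  ext1 a
  rw [PowerSeries.coeff_C_mul, PowerSeries.coeff_X_pow, coeffwise, integralSeries,
    PowerSeries.coeff_mk, PowerSeries.coeff_mk]
  rcases eq_or_ne a 0 with rfl | ha
  · simp [hj.symm]
  rw [if_neg ha, MvPolynomial.pderiv_mul, pderiv_X_zero_pow hj, mul_zero, add_zero]
  rcases eq_or_ne a j with rfl | h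
  · simp
  · simp [MvPolynomial.pderiv_X_of_ne h, h]

theorem coeffwise_pderiv_integralPartialSeries {m j : ℕ} (hj : m < j) :
    coeffwise (MvPolynomial.pderiv j) (integralPartialSeries f m) = 0 := by
  ext1 a
  rw [coeffwise, integralPartialSeries, PowerSeries.coeff_mk, PowerSeries.coeff_mk, map_zero]
  split_ifs with h1 h2
  · simp
  · rw [MvPolynomial.pderiv_mul, pderiv_X_zero_pow (by omega),
      MvPolynomial.pderiv_X_of_ne (by omega)]
    simp
  · simp

/-! ### Partial derivatives of the square root -/

section Sqrt

variable {s t : (MvPolynomial ℕ f)⟦X⟧}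

/-- For `j ≠ 0` the variable `x_j` occurs in `F` only in `x_j x_0^{j-1} z^j`; differentiate `s ^ 2 =
F` and multiply by `t = 1/s`. -/
theorem two_mul_pderiv_coeff_sqrt (hs : s ^ 2 = integralSeries f) (hst : s * t = 1) {j : ℕ}
    (hj : j ≠ 0) (a : ℕ) :
    2 * MvPolynomial.pderiv j (PowerSeries.coeff (a + j) s) =
      MvPolynomial.X 0 ^ (j - 1) * PowerSeries.coeff a t := by
  have h := coeffwise_pderiv_integralSeries (f := f) hj
  rw [← hs, sq, coeffwise_mul] at h
  have h2 : coeffwise (MvPolynomial.pderiv j) s + coeffwise (MvPolynomial.pderiv j) s =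
      PowerSeries.C (MvPolynomial.X 0 ^ (j - 1)) * (PowerSeries.X ^ j * t) := by
    linear_combination t * h -
      2 * (coeffwise (MvPolynomial.pderiv j) s) * hst
  have h3 := congrArg (PowerSeries.coeff (a + j)) h2
  rw [PowerSeries.coeff_C_mul, PowerSeries.coeff_X_pow_mul, map_add, coeffwise,
    PowerSeries.coeff_mk] at h3
  rw [two_mul, h3]

/-- The sum is `2i` times the coefficient of `z^i` in `F t = s` minus the coefficient of `z^i` in
`zF' t = 2zs'`, and both equal `2i s_i`. -/
theorem sum_integralSeries_mul_inv_sqrt (hs : s ^ 2 = integralSeries f) (hst : s * t = 1) (i : ℕ) :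
    ∑ p ∈ Finset.range (i + 1), (2 * i - p : MvPolynomial ℕ f) *
      (PowerSeries.coeff p (integralSeries f) * PowerSeries.coeff (i - p) t) = 0 := by
  have h1 : integralSeries f * t = s := by linear_combination -t * hs + s * hst
  have h2 : (PowerSeries.X * PowerSeries.derivative _ (integralSeries f)) * t =
      PowerSeries.X * PowerSeries.derivative _ s + PowerSeries.X * PowerSeries.derivative _ s := by
    rw [← hs, sq, Derivation.leibniz, smul_eq_mul]
    linear_combination 2 * (PowerSeries.X * PowerSeries.derivative _ s) * hst
  have h3 (g : (MvPolynomial ℕ f)⟦X⟧) (a : ℕ) :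
      PowerSeries.coeff a (PowerSeries.X * PowerSeries.derivative _ g) =
        a * PowerSeries.coeff a g := by
    cases a with
    | zero => simp
    | succ b => rw [PowerSeries.coeff_succ_X_mul, PowerSeries.coeff_derivative]; push_cast; ring
  have h4 := congrArg (PowerSeries.coeff i) h1
  have h5 := congrArg (PowerSeries.coeff i) h2
  rw [PowerSeries.coeff_mul, Finset.Nat.sum_antidiagonal_eq_sum_range_succ_mk] at h4 h5
  simp only [h3, map_add] at h5
  simp only [sub_mul, Finset.sum_sub_distrib, ← Finset.mul_sum, h4]
  simp only [← mul_assoc] at h5 ⊢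
  rw [h5]; ring

/-- Specialize `x_1` to `1` and all other variables to `0`. Then `F` becomes `1 + X` and `t` becomes
`(1 + X)^{-1/2}`, whose coefficients are nonzero, while a multiple of `x_0` would vanish. -/
theorem not_X_zero_dvd_coeff_inv_sqrt [CharZero f] (hs : s ^ 2 = integralSeries f)
    (hst : s * t = 1) (hc : PowerSeries.constantCoeff s = 1) (a : ℕ) :
    ¬ MvPolynomial.X 0 ∣ PowerSeries.coeff a t := by
  set φ : MvPolynomial ℕ f →+* f :=
    ((MvPolynomial.aeval fun j => if j = 1 then (1 : f) else 0 : MvPolynomial ℕ f →ₐ[f] f) :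
      MvPolynomial ℕ f →+* f) with hφ
  have hφX (j : ℕ) : φ (MvPolynomial.X j) = if j = 1 then 1 else 0 := by simp [hφ]
  have hF : PowerSeries.map φ (integralSeries f) = 1 + PowerSeries.X := by
    ext1 a
    rw [PowerSeries.coeff_map, integralSeries, PowerSeries.coeff_mk, map_add, PowerSeries.coeff_one,
      PowerSeries.coeff_X]
    rcases a with _ | _ | a
    · simp
    · simp [hφX]
    · simp [hφX]
  have ht : PowerSeries.constantCoeff t = 1 := by
    have := congrArg PowerSeries.constantCoeff hst
    rwa [map_mul, hc, one_mul, map_one] at this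
  have h1 : t ^ 2 * integralSeries f = 1 := by rw [← hs, ← mul_pow, mul_comm, hst, one_pow]
  have h2 := congrArg (PowerSeries.map φ) h1
  rw [map_mul, map_pow, hF, map_one] at h2
  have h3 := coeff_ne_zero_of_sq_mul_one_add_X (t := PowerSeries.map φ t)
    (by rw [← PowerSeries.coeff_zero_eq_constantCoeff_apply, PowerSeries.coeff_map,
      PowerSeries.coeff_zero_eq_constantCoeff_apply, ht, map_one]) h2 a
  rintro ⟨b, hb⟩
  rw [PowerSeries.coeff_map, hb, map_mul, hφX] at h3
  simp at h3

theorem coeff_X_zero_mul (p : ℕ) :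
    MvPolynomial.X p * MvPolynomial.X 0 ^ p =
      MvPolynomial.X 0 * PowerSeries.coeff p (integralSeries f) := by
  rw [integralSeries, PowerSeries.coeff_mk]
  rcases p with _ | p
  · simp
  · simp only [Nat.add_eq_zero_iff, one_ne_zero, and_false, if_false, Nat.add_sub_cancel]; ring

end Sqrt

/-- Besides the generating function, this records the only properties of `P_{mk}` that the center
needs: its derivative in the last variable, nondivisibility by `x_0` of its derivative in `x_{m+1}`,
and annihilation by the derivations `D_i`. -/
theorem exists_generating_polynomials [CharZero f] (m : ℕ) :
    ∃ Q : ℕ → MvPolynomial ℕ f,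
      (∀ k, Q k ∈ MvPolynomial.supported f {j | j ≤ m + k}) ∧
      (∃ s r : (MvPolynomial ℕ f)⟦X⟧, IsSqrt (PowerSeries.map (algebraMap _ (RatFun f)) s)
          (fullSeries f) ∧
        IsSqrt (PowerSeries.map (algebraMap _ (RatFun f)) r) (partialSeries f m) ∧
        PowerSeries.C (MvPolynomial.X 0 ^ m) * PowerSeries.X ^ m *
          (PowerSeries.mk fun k => if k = 0 then 0 else Q k) = s - r) ∧
      ∀ k, 1 ≤ k → 2 * MvPolynomial.pderiv (m + k) (Q k) = MvPolynomial.X 0 ^ (k - 1) ∧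
        ¬ MvPolynomial.X 0 ∣ MvPolynomial.pderiv (m + 1) (Q k) ∧
        ∀ i, 1 ≤ i → i < k → ∑ p ∈ Finset.range (i + 1),
          ((2 * i - p : MvPolynomial ℕ f) * MvPolynomial.X p) *
            MvPolynomial.pderiv (m + k - i + p) (Q k) = 0 := by
  let _ : Algebra ℚ f := DivisionRing.toRatAlgebra
  obtain ⟨s, hsc, hs⟩ := exists_sq_eq_of_constantCoeff_eq_one (integralSeries f)
    (by simp [integralSeries])
  obtain ⟨r, hrc, hr⟩ := exists_sq_eq_of_constantCoeff_eq_one (integralPartialSeries f m)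
    (by simp [integralPartialSeries])
  have hx0 : x f 0 ≠ 0 := by
    rw [x, Ne, FaithfulSMul.algebraMap_eq_zero_iff]; exact MvPolynomial.X_ne_zero _
  have hsS : s ∈ filteredSeries (initialVars f m) (initialVars_mono m) :=
    mem_filteredSeries_of_sq_mem hsc (hs ▸ integralSeries_mem m)
  have hrS : r ∈ filteredSeries (initialVars f m) (initialVars_mono m) :=
    mem_filteredSeries_of_sq_mem hrc (hr ▸ integralPartialSeries_mem m)
  obtain ⟨t, hst⟩ : ∃ t, s * t = 1 :=
    (PowerSeries.isUnit_iff_constantCoeff.mpr (by rw [hsc]; exact isUnit_one)).exists_right_inv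
  have hsrc : PowerSeries.constantCoeff (s + r) = 2 := by rw [map_add, hsc, hrc]; norm_num
  obtain ⟨v, hv⟩ : ∃ v, (s + r) * v = 1 := by
    refine (PowerSeries.isUnit_iff_constantCoeff.mpr ?_).exists_right_inv
    rw [hsrc]
    have : (2 : MvPolynomial ℕ f) = MvPolynomial.C 2 := (map_ofNat MvPolynomial.C 2).symm
    rw [this]
    exact (IsUnit.mk0 (2 : f) two_ne_zero).map MvPolynomial.C
  -- The quotient `(s - r) / (x_0^m z^m)`, written as `tail / (s + r)` so that no division by `x_0`
  -- occurs.
  set q := tailSeries f m * v with hq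
  have hq1 : (s + r) * q = tailSeries f m := by rw [hq]; linear_combination tailSeries f m * hv
  have hqS : q ∈ filteredSeries (initialVars f m) (initialVars_mono m) :=
    mem_filteredSeries_of_mul_eq (tailSeries_mem m) (add_mem hsS hrS) hsrc hq1
  have hq0 : PowerSeries.coeff 0 q = 0 := by
    rw [hq, PowerSeries.coeff_zero_eq_constantCoeff_apply, map_mul]
    simp [tailSeries]
  have hgen : PowerSeries.C (MvPolynomial.X 0 ^ m) * PowerSeries.X ^ m * q = s - r := by
    have := integralSeries_sub_integralPartialSeries (f := f) m
    rw [← hs, ← hr, ← hq1] at this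
    linear_combination (-v) * this +
      (s - r - PowerSeries.C (MvPolynomial.X 0 ^ m) * PowerSeries.X ^ m * q) * hv
  have hmk : (PowerSeries.mk fun k => if k = 0 then 0 else PowerSeries.coeff k q) = q := by
    ext1 k
    rw [PowerSeries.coeff_mk]
    split_ifs with h
    · rw [h, hq0]
    · rfl
  have hcoef (k : ℕ) : MvPolynomial.X 0 ^ m * PowerSeries.coeff k q =
      PowerSeries.coeff (k + m) s - PowerSeries.coeff (k + m) r := by
    rw [← map_sub, ← hgen, mul_assoc, PowerSeries.coeff_C_mul, PowerSeries.coeff_X_pow_mul]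
  -- `r` involves only `x_0, …, x_m`, so it drops out of the derivatives below.
  have hr0 {j : ℕ} (hj : m < j) (a : ℕ) :
      MvPolynomial.pderiv j (PowerSeries.coeff a r) = 0 := by
    have h := coeffwise_pderiv_integralPartialSeries (f := f) hj
    rw [← hr, sq, coeffwise_mul, ← two_mul, ← mul_assoc] at h
    have hr2 : 2 * r ≠ 0 := by
      intro h
      have := congrArg PowerSeries.constantCoeff h
      rw [map_mul, hrc, mul_one, map_ofNat, map_zero] at this
      exact two_ne_zero this
    have := congrArg (PowerSeries.coeff a) ((mul_eq_zero.mp h).resolve_left hr2)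
    rwa [coeffwise, PowerSeries.coeff_mk, map_zero] at this
  have key (a b : ℕ) : 2 * MvPolynomial.pderiv (m + 1 + a) (PowerSeries.coeff (a + 1 + b) q) =
      MvPolynomial.X 0 ^ a * PowerSeries.coeff b t := by
    have h1 := congrArg (MvPolynomial.pderiv (m + 1 + a)) (hcoef (a + 1 + b))
    rw [MvPolynomial.pderiv_mul, pderiv_X_zero_pow (by omega), zero_mul, zero_add, map_sub,
      hr0 (by omega), sub_zero, show a + 1 + b + m = b + (m + 1 + a) by omega] at h1
    have h2 := two_mul_pderiv_coeff_sqrt hs hst (j := m + 1 + a) (by omega) b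
    rw [← h1, show m + 1 + a - 1 = m + a by omega] at h2
    refine mul_left_cancel₀ (pow_ne_zero m (MvPolynomial.X_ne_zero 0)) ?_
    linear_combination h2
  have ht : PowerSeries.coeff 0 t = 1 := by
    have := congrArg PowerSeries.constantCoeff hst
    rw [map_mul, hsc, one_mul, map_one] at this
    rw [PowerSeries.coeff_zero_eq_constantCoeff_apply, this]
  refine ⟨fun k => PowerSeries.coeff k q, hqS, ⟨s, r, ⟨?_, ?_⟩, ⟨?_, ?_⟩, ?_⟩,
    fun k hk => ⟨?_, ?_, ?_⟩⟩
  · rw [← PowerSeries.coeff_zero_eq_constantCoeff_apply, PowerSeries.coeff_map,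
      PowerSeries.coeff_zero_eq_constantCoeff_apply, hsc, map_one]
  · rw [← map_pow, hs]
    ext1 k
    rw [PowerSeries.coeff_map, integralSeries, fullSeries, PowerSeries.coeff_mk,
      PowerSeries.coeff_mk]
    rcases k with _ | k
    · simp [hx0]
    · simp [x]
  · rw [← PowerSeries.coeff_zero_eq_constantCoeff_apply, PowerSeries.coeff_map,
      PowerSeries.coeff_zero_eq_constantCoeff_apply, hrc, map_one]
  · rw [← map_pow, hr]
    ext1 k
    rw [PowerSeries.coeff_map, integralPartialSeries, partialSeries, PowerSeries.coeff_mk,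
      PowerSeries.coeff_mk]
    rcases k with _ | k
    · simp [hx0]
    · by_cases h : k + 1 ≤ m <;> simp [x, h]
  · rw [hmk, hgen]
  · obtain ⟨a, rfl⟩ := Nat.exists_eq_add_of_le' hk
    have := key a 0
    rwa [ht, mul_one, add_zero, show m + 1 + a = m + (a + 1) by omega] at this
  · obtain ⟨b, rfl⟩ := Nat.exists_eq_add_of_le' hk
    have := key 0 b
    rw [pow_zero, one_mul, add_zero, zero_add, add_comm 1 b] at this
    intro h
    exact not_X_zero_dvd_coeff_inv_sqrt hs hst hsc b (this ▸ dvd_mul_of_dvd_right h 2)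
  · intro i hi hik
    refine (mul_eq_zero.mp (?_ : (2 : MvPolynomial ℕ f) * _ = 0)).resolve_left two_ne_zero
    have := sum_integralSeries_mul_inv_sqrt hs hst i
    -- By `key`, twice the `p`-th summand is `(2i - p) x_p x_0^{k-1-i+p} t_{i-p}`; as `x_p x_0^p =
    -- x_0 F_p`, this is `x_0^{k-i}` times the `p`-th summand of the identity for `F` and `t`.
    apply_fun (fun a => MvPolynomial.X 0 ^ (k - 1 - i + 1) * a) at this
    rw [mul_zero] at this
    rw [← this, Finset.mul_sum, Finset.mul_sum]
    refine Finset.sum_congr rfl fun p hp => ?_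
    rw [Finset.mem_range] at hp
    have h1 := key (k - 1 - i + p) (i - p)
    rw [show m + 1 + (k - 1 - i + p) = m + k - i + p by omega,
      show k - 1 - i + p + 1 + (i - p) = k by omega, pow_add] at h1
    have h2 := coeff_X_zero_mul (f := f) p
    rw [pow_add, pow_one]
    linear_combination (2 * i - p : MvPolynomial ℕ f) * MvPolynomial.X p * h1 +
      (2 * i - p : MvPolynomial ℕ f) * MvPolynomial.X 0 ^ (k - 1 - i) *
        PowerSeries.coeff (i - p) t * h2

theorem exists_rename_eq {N : ℕ} {Q : MvPolynomial ℕ f}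
    (hQ : Q ∈ MvPolynomial.supported f {j | j ≤ N}) :
    ∃ P : MvPolynomial (Fin (N + 1)) f, MvPolynomial.rename Fin.val P = Q := by
  refine MvPolynomial.exists_rename_eq_of_vars_subset_range Q _ Fin.val_injective ?_
  rw [MvPolynomial.mem_supported] at hQ
  intro j hj
  exact ⟨⟨j, Nat.lt_succ_of_le (hQ hj)⟩, rfl⟩

open MvPolynomial

/-! ### Derivations and polynomials over a ring of constants -/

section Polynomials

variable {f : Type*} [Field f]

theorem mem_supported_of_pderiv_eq_zero {σ : Type*} [CharZero f] {S : Set σ} {g : MvPolynomial σ f}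
    (h : ∀ j ∉ S, pderiv j g = 0) : g ∈ supported f S := by
  classical
  rw [mem_supported]
  intro j hj
  by_contra hjS
  obtain ⟨s, hs, hjs⟩ := (mem_vars_iff_mem_support j).mp hj
  have h1 := congrArg (coeff (s - Finsupp.single j 1)) (h j hjS)
  have hj1 : 1 ≤ s j := Nat.one_le_iff_ne_zero.mpr (Finsupp.mem_support_iff.mp hjs)
  rw [coeff_pderiv, tsub_add_cancel_of_le (Finsupp.single_le_iff.mpr hj1), coeff_zero] at h1
  rcases mul_eq_zero.mp h1 with h2 | h2
  · exact mem_support_iff.mp hs h2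
  · exact (Nat.cast_add_one_ne_zero _ h2 : False)

theorem pderiv_eq_zero_of_mem_supported {σ : Type*} {S : Set σ} {g : MvPolynomial σ f}
    (hg : g ∈ supported f S) {j : σ} (hj : j ∉ S) : pderiv j g = 0 :=
  pderiv_eq_zero_of_notMem_vars fun h => hj (mem_supported.mp hg h)

theorem _root_.Polynomial.exists_derivative_eq {B : Type*} [CommRing B] [CharZero f] [Algebra f B]
    (A : Polynomial B) : ∃ C : Polynomial B, Polynomial.derivative C = A := by
  induction A using Polynomial.induction_on' with
  | add p q hp hq =>
    obtain ⟨a, rfl⟩ := hp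
    obtain ⟨b, rfl⟩ := hq
    exact ⟨a + b, map_add _ _ _⟩
  | monomial n a =>
    refine ⟨Polynomial.monomial (n + 1) (((n + 1 : ℕ) : f)⁻¹ • a), ?_⟩
    rw [Polynomial.derivative_monomial, Nat.add_sub_cancel, mul_comm, ← nsmul_eq_mul,
      ← Nat.cast_smul_eq_nsmul f, smul_smul, mul_inv_cancel₀ (Nat.cast_ne_zero.mpr n.succ_ne_zero),
      one_smul]

variable {R : Type*} [CommRing R] [Algebra f R] {B : Subalgebra f R}

theorem derivation_aeval (D : Derivation f R R) (hD : ∀ b ∈ B, D b = 0) (q : R)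
    (A : Polynomial B) :
    D (Polynomial.aeval q A) = Polynomial.aeval q (Polynomial.derivative A) * D q := by
  induction A using Polynomial.induction_on' with
  | add p r hp hr => simp only [map_add, hp, hr, add_mul]
  | monomial n a =>
    rw [Polynomial.aeval_monomial, Derivation.leibniz, Polynomial.derivative_monomial,
      Polynomial.aeval_monomial, Derivation.leibniz_pow, map_mul, map_natCast]
    have : D (algebraMap B R a) = 0 := hD _ a.2
    rw [this, smul_zero, add_zero]
    simp only [smul_eq_mul, nsmul_eq_mul]; ring

/-- Applying `D` to `A(q)` gives `A'(q) * D q`, so `A'(q) ∈ I` by primality, and induction on the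
degree puts all nonconstant coefficients in `I`; the constant one follows. Used with `I = (x_0)` to
cancel `x_0` and with `I = ⊥` for transcendence. -/
theorem coeff_mem_of_aeval_mem [CharZero f] (D : Derivation f R R) (hD : ∀ b ∈ B, D b = 0)
    (I : Ideal R) [I.IsPrime] (hI : ∀ a ∈ I, D a ∈ I) {q : R} (hq : D q ∉ I) (A : Polynomial B)
    (hA : Polynomial.aeval q A ∈ I) (i : ℕ) : (A.coeff i : R) ∈ I := by
  induction hn : A.natDegree using Nat.strong_induction_on generalizing A i with
  | _ n ih =>
    have hpos (j : ℕ) : (A.coeff (j + 1) : R) ∈ I := by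
      -- In degree `0` differentiation does not lower the degree, but there are no higher
      -- coefficients.
      rcases Nat.eq_zero_or_pos n with h0 | h0
      · rw [Polynomial.coeff_eq_zero_of_natDegree_lt (by omega)]; exact I.zero_mem
      have h1 := hI _ hA
      rw [derivation_aeval D hD] at h1
      have h2 := (Ideal.IsPrime.mem_or_mem ‹_› h1).resolve_right hq
      have h3 := ih _ (hn ▸ Polynomial.natDegree_derivative_lt (by omega)) _ h2 j rfl
      rw [Polynomial.coeff_derivative] at h3
      have h4 : ((A.coeff (j + 1) * ((j : B) + 1) : B) : R) =
          ((j + 1 : ℕ) : f) • (A.coeff (j + 1) : R) := by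
        rw [Nat.cast_smul_eq_nsmul, nsmul_eq_mul]; push_cast; ring
      rw [h4] at h3
      have h5 := Submodule.smul_of_tower_mem I (((j + 1 : ℕ) : f)⁻¹) h3
      rwa [smul_smul, inv_mul_cancel₀ (Nat.cast_ne_zero.mpr j.succ_ne_zero), one_smul] at h5
    cases i with
    | succ j => exact hpos j
    | zero =>
      rw [Polynomial.aeval_eq_sum_range, Finset.sum_range_succ', pow_zero] at hA
      have h6 : A.coeff 0 • (1 : R) = (A.coeff 0 : R) := by rw [Algebra.smul_def, mul_one]; rfl
      rw [h6] at hA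
      refine (I.add_mem_iff_right (sum_mem fun j _ => ?_)).mp hA
      rw [Algebra.smul_def]
      exact I.mul_mem_right _ (hpos j)

end Polynomials

/-! ### The common kernel of the derivations `D_i` -/

variable {f : Type*} [Field f]

/-- The derivation `∑_{p ≤ i} (2i - p) x_p ∂/∂x_{h-i+p}`. -/
def shiftDerivation (f : Type*) [Field f] (h i : ℕ) :
    Derivation f (MvPolynomial ℕ f) (MvPolynomial ℕ f) :=
  ∑ p ∈ Finset.range (i + 1), ((2 * i - p : MvPolynomial ℕ f) * X p) • pderiv (h - i + p)

theorem shiftDerivation_apply (h i : ℕ) (g : MvPolynomial ℕ f) :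
    shiftDerivation f h i g = ∑ p ∈ Finset.range (i + 1),
      ((2 * i - p : MvPolynomial ℕ f) * X p) * pderiv (h - i + p) g := by
  rw [shiftDerivation]
  induction Finset.range (i + 1) using Finset.induction_on with
  | empty => simp
  | insert p S hp ih =>
    rw [Finset.sum_insert hp, Finset.sum_insert hp, Derivation.add_apply, ih,
      Derivation.smul_apply, smul_eq_mul]

theorem shiftDerivation_eq_zero {h i m : ℕ} (hm : m < h - i) {g : MvPolynomial ℕ f}
    (hg : g ∈ supported f {j | j ≤ m}) : shiftDerivation f h i g = 0 := by
  rw [shiftDerivation_apply]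
  refine Finset.sum_eq_zero fun p _ => ?_
  have hj : h - i + p ∉ {j | j ≤ m} := by simp; omega
  rw [pderiv_eq_zero_of_mem_supported hg hj, mul_zero]

theorem pderiv_pderiv_comm {σ : Type*} (i j : σ) (g : MvPolynomial σ f) :
    pderiv i (pderiv j g) = pderiv j (pderiv i g) := by
  classical
  have : ⁅(pderiv i : Derivation f (MvPolynomial σ f) (MvPolynomial σ f)),
      (pderiv j : Derivation f (MvPolynomial σ f) (MvPolynomial σ f))⁆ = 0 := by
    refine derivation_ext fun k => ?_
    rw [Derivation.commutator_apply, pderiv_X, pderiv_X]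
    simp [Pi.single_apply, apply_ite]
  have h := congrArg (fun D : Derivation f (MvPolynomial σ f) (MvPolynomial σ f) => D g) this
  simpa [Derivation.commutator_apply, sub_eq_zero] using h

/-- The coefficients of `D_i` involve only `x_p` with `p ≤ i < h`, hence not `x_h`. -/
theorem pderiv_shiftDerivation {h i : ℕ} (hi : i < h) (g : MvPolynomial ℕ f) :
    shiftDerivation f h i (pderiv h g) = pderiv h (shiftDerivation f h i g) := by
  rw [shiftDerivation_apply, shiftDerivation_apply, map_sum]
  refine Finset.sum_congr rfl fun p hp => ?_
  rw [Finset.mem_range] at hp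
  have h1 : pderiv h ((2 * i - p : MvPolynomial ℕ f) * X p) = 0 := by
    have h2 : (2 * i - p : MvPolynomial ℕ f) = C (2 * i - p : f) := by
      rw [map_sub, map_mul, map_natCast, map_natCast, map_ofNat]
    rw [h2, pderiv_C_mul, pderiv_X_of_ne (by omega), mul_zero]
  rw [pderiv_mul, h1, zero_mul, zero_add, pderiv_pderiv_comm]

/-- The system is triangular: once the derivatives in `x_{m+k-i+1}, …, x_{m+k}` vanish, `D_i g = 0`
reduces to `2i x_0 ∂g/∂x_{m+k-i} = 0`. -/
theorem mem_supported_of_shiftDerivation_eq_zero [CharZero f] {m k : ℕ} {g : MvPolynomial ℕ f}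
    (hg : ∀ j, m + k ≤ j → pderiv j g = 0)
    (h : ∀ i, 1 ≤ i → i < k → shiftDerivation f (m + k) i g = 0) :
    g ∈ supported f {j | j ≤ m} := by
  refine mem_supported_of_pderiv_eq_zero fun j hj => ?_
  rw [Set.mem_ofPred_eq, not_le] at hj
  rcases le_or_gt (m + k) j with h1 | h1
  · exact hg j h1
  have key (i : ℕ) : i < k → pderiv (m + k - i) g = 0 := by
    induction i using Nat.strong_induction_on with
    | _ i ih =>
      intro hik
      rcases Nat.eq_zero_or_pos i with rfl | hi
      · exact hg _ le_rfl
      have h2 := h i hi hik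
      rw [shiftDerivation_apply, Finset.sum_range_succ', Finset.sum_eq_zero, zero_add, add_zero,
        Nat.cast_zero, sub_zero] at h2
      · refine (mul_eq_zero.mp h2).resolve_left (mul_ne_zero (mul_ne_zero two_ne_zero ?_)
          (X_ne_zero _))
        exact Nat.cast_ne_zero.mpr hi.ne'
      · intro p hp
        rw [Finset.mem_range] at hp
        rw [show m + k - i + (p + 1) = m + k - (i - (p + 1)) by omega,
          ih _ (by omega) (by omega), mul_zero]
  have := key (m + k - j) (by omega)
  rwa [show m + k - (m + k - j) = j by omega] at this

/-- All coefficients of `A` are divisible by `x_0`, because `(x_0)` is a prime ideal stable under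
`∂/∂x_{m+1}` and not containing `∂Q/∂x_{m+1}`. The cofactors again involve only `x_0, …, x_m`. -/
theorem exists_aeval_eq_of_X_mul_eq [CharZero f] {m : ℕ} {Q : MvPolynomial ℕ f}
    (hQ : ¬ X 0 ∣ pderiv (m + 1) Q) {g : MvPolynomial ℕ f}
    {A : Polynomial (supported f {j : ℕ | j ≤ m})} (hA : Polynomial.aeval Q A = X 0 * g) :
    ∃ A' : Polynomial (supported f {j : ℕ | j ≤ m}), Polynomial.aeval Q A' = g := by
  have hp : (Ideal.span {(X 0 : MvPolynomial ℕ f)}).IsPrime :=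
    (Ideal.span_singleton_prime (X_ne_zero _)).mpr X_prime
  have hX0 : (X 0 : MvPolynomial ℕ f) ∈ supported f {j : ℕ | j ≤ m} :=
    X_mem_supported.mpr (Nat.zero_le _)
  have h1 (i : ℕ) := coeff_mem_of_aeval_mem (B := supported f {j : ℕ | j ≤ m}) (pderiv (m + 1))
    (fun b hb => pderiv_eq_zero_of_mem_supported hb (by simp))
    (Ideal.span {(X 0 : MvPolynomial ℕ f)}) (fun a ha => by
      rw [Ideal.mem_span_singleton] at ha ⊢
      obtain ⟨b, rfl⟩ := ha
      rw [pderiv_mul, pderiv_X_of_ne (by omega), zero_mul, zero_add]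
      exact dvd_mul_right _ _) (q := Q) (by rwa [Ideal.mem_span_singleton]) A
    (by rw [hA, Ideal.mem_span_singleton]; exact dvd_mul_right _ _) i
  have h2 : Polynomial.C (⟨X 0, hX0⟩ : supported f {j : ℕ | j ≤ m}) ∣ A := by
    rw [Polynomial.C_dvd_iff_dvd_coeff]
    intro i
    obtain ⟨b, hb⟩ := Ideal.mem_span_singleton.mp (h1 i)
    refine ⟨⟨b, mem_supported_of_pderiv_eq_zero fun j hj => ?_⟩, Subtype.ext hb⟩
    have h3 := pderiv_eq_zero_of_mem_supported (A.coeff i).2 hj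
    rw [hb, pderiv_mul, pderiv_X_of_ne (by rintro rfl; simp at hj), zero_mul, zero_add] at h3
    exact (mul_eq_zero.mp h3).resolve_left (X_ne_zero _)
  obtain ⟨A', rfl⟩ := h2
  refine ⟨A', mul_left_cancel₀ (X_ne_zero 0) ?_⟩
  rw [← hA, map_mul, Polynomial.aeval_C]
  rfl

theorem exists_aeval_eq_of_X_pow_mul_eq [CharZero f] {m : ℕ} {Q : MvPolynomial ℕ f}
    (hQ : ¬ X 0 ∣ pderiv (m + 1) Q) (e : ℕ) {g : MvPolynomial ℕ f}
    {A : Polynomial (supported f {j : ℕ | j ≤ m})} (hA : Polynomial.aeval Q A = X 0 ^ e * g) :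
    ∃ A' : Polynomial (supported f {j : ℕ | j ≤ m}), Polynomial.aeval Q A' = g := by
  induction e generalizing A with
  | zero => exact ⟨A, by rw [hA, pow_zero, one_mul]⟩
  | succ e ih =>
    rw [pow_succ', mul_assoc] at hA
    obtain ⟨A', hA'⟩ := exists_aeval_eq_of_X_mul_eq hQ hA
    exact ih hA'

theorem exists_aeval_eq_of_shiftDerivation_eq_zero [CharZero f] {m k : ℕ} (hk : 1 ≤ k)
    {Q : MvPolynomial ℕ f} (hQs : Q ∈ supported f {j | j ≤ m + k})
    (hQ1 : 2 * pderiv (m + k) Q = X 0 ^ (k - 1)) (hQ2 : ¬ X 0 ∣ pderiv (m + 1) Q)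
    (hQ3 : ∀ i, 1 ≤ i → i < k → shiftDerivation f (m + k) i Q = 0) {g : MvPolynomial ℕ f}
    (hgs : g ∈ supported f {j | j ≤ m + k})
    (hg : ∀ i, 1 ≤ i → i < k → shiftDerivation f (m + k) i g = 0) :
    ∃ A : Polynomial (supported f {j : ℕ | j ≤ m}), Polynomial.aeval Q A = g := by
  -- Induction on a strict bound `N` for the degree in `x_{m+k}`; the derivative in `x_{m+k}` stays
  -- in the kernel and has a smaller bound.
  suffices H : ∀ N, ∀ g ∈ supported f {j | j ≤ m + k},
      (∀ i, 1 ≤ i → i < k → shiftDerivation f (m + k) i g = 0) →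
      (∀ s : ℕ →₀ ℕ, N ≤ s (m + k) → coeff s g = 0) →
      ∃ A : Polynomial (supported f {j : ℕ | j ≤ m}), Polynomial.aeval Q A = g by
    refine H (degreeOf (m + k) g + 1) g hgs hg fun s hs => ?_
    by_contra h
    have := monomial_le_degreeOf (m + k) (mem_support_iff.mpr h)
    omega
  intro N
  induction N with
  | zero => exact fun g _ _ h => ⟨0, by ext s; simp [h s]⟩
  | succ N ih =>
    intro g hgs hg hN
    obtain ⟨A, hA⟩ := ih (pderiv (m + k) g)
      (mem_supported_of_pderiv_eq_zero fun j hj => by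
        rw [pderiv_pderiv_comm, pderiv_eq_zero_of_mem_supported hgs hj, map_zero])
      (fun i h1 h2 => by rw [pderiv_shiftDerivation (by omega), hg i h1 h2, map_zero])
      (fun s hs => by rw [coeff_pderiv, hN _ (by simpa using hs), zero_mul])
    obtain ⟨C, rfl⟩ := Polynomial.exists_derivative_eq (f := f) A
    -- Since `2 ∂Q/∂x_{m+k} = x_0^{k-1}` and `C'(Q) = ∂g/∂x_{m+k}`, the derivative of `w` in
    -- `x_{m+k}` is zero, and `w` is still in the kernel of each `D_i`.
    set w := X 0 ^ (k - 1) * g - 2 * Polynomial.aeval Q C with hw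
    have hD (D : Derivation f (MvPolynomial ℕ f) (MvPolynomial ℕ f))
        (hD : ∀ b ∈ supported f {j : ℕ | j ≤ m}, D b = 0) : D w = X 0 ^ (k - 1) * D g -
          2 * (Polynomial.aeval Q (Polynomial.derivative C) * D Q) := by
      have h0 : D (X 0 ^ (k - 1)) = 0 :=
        hD _ (pow_mem (X_mem_supported.mpr (show 0 ∈ {j : ℕ | j ≤ m} from Nat.zero_le m)) _)
      have h2 : D 2 = 0 := hD _ (ofNat_mem _ 2)
      rw [hw, map_sub, Derivation.leibniz, Derivation.leibniz, h0, h2, derivation_aeval D hD]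
      simp
    have hwB : w ∈ supported f {j : ℕ | j ≤ m} := by
      refine mem_supported_of_shiftDerivation_eq_zero (k := k) (fun j hj => ?_) fun i h1 h2 => ?_
      · rw [hD _ fun b hb => pderiv_eq_zero_of_mem_supported hb (by simp; omega)]
        rcases hj.eq_or_lt with rfl | hj
        · rw [← hA, ← hQ1]; ring
        · rw [pderiv_eq_zero_of_mem_supported hgs (by simpa using hj),
            pderiv_eq_zero_of_mem_supported hQs (by simpa using hj)]
          ring
      · rw [hD _ fun b hb => shiftDerivation_eq_zero (by omega) hb, hg i h1 h2, hQ3 i h1 h2]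
        ring
    refine exists_aeval_eq_of_X_pow_mul_eq hQ2 (k - 1) (A := 2 * C + Polynomial.C ⟨w, hwB⟩) ?_
    rw [map_add, map_mul, Polynomial.aeval_C, map_ofNat]
    change 2 * Polynomial.aeval Q C + w = _
    rw [hw]; ring

theorem algebraicIndependent_X_fin (m : ℕ) :
    AlgebraicIndependent f fun j : Fin (m + 1) => (X (j : ℕ) : MvPolynomial ℕ f) :=
  (algebraicIndependent_X ℕ f).comp _ Fin.val_injective

theorem supported_eq_adjoin_range (m : ℕ) : (supported f {j : ℕ | j ≤ m}) =
    Algebra.adjoin f (Set.range fun j : Fin (m + 1) => (X (j : ℕ) : MvPolynomial ℕ f)) := by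
  rw [supported_eq_adjoin_X]
  congr 1
  ext p
  constructor
  · rintro ⟨j, hj, rfl⟩
    exact ⟨⟨j, Nat.lt_succ_of_le hj⟩, rfl⟩
  · rintro ⟨j, rfl⟩
    exact ⟨j, Nat.le_of_lt_succ j.2, rfl⟩

theorem algebraicIndependent_snoc [CharZero f] {m : ℕ} {Q : MvPolynomial ℕ f}
    (hQ : ¬ X 0 ∣ pderiv (m + 1) Q) :
    AlgebraicIndependent f (Fin.snoc (α := fun _ : Fin (m + 2) => MvPolynomial ℕ f)
      (fun j : Fin (m + 1) => X (j : ℕ)) Q) := by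
  have h2 : Transcendental (supported f {j : ℕ | j ≤ m}) Q := by
    rw [transcendental_iff]
    intro A hA
    ext1 i
    have := coeff_mem_of_aeval_mem (pderiv (m + 1))
      (fun b hb => pderiv_eq_zero_of_mem_supported hb (by simp)) ⊥
      (fun a ha => by rw [Ideal.mem_bot.mp ha, map_zero]; exact zero_mem _) (q := Q)
      (fun h => hQ (by rw [Ideal.mem_bot.mp h]; exact dvd_zero _)) A
      (by rw [hA]; exact zero_mem _) i
    exact Subtype.ext (Ideal.mem_bot.mp this)
  rw [supported_eq_adjoin_range, ← (algebraicIndependent_X_fin m).option_iff_transcendental] at h2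
  have h3 := h2.comp finSuccEquivLast finSuccEquivLast.injective
  convert h3 using 1
  funext j
  induction j using Fin.lastCases with
  | last => simp
  | cast j => simp

/-! ### Ordered monomials and commutators in an algebra with Witt relations -/

variable {f : Type*} [Field f] {A : Type*} [Ring A]

/-- The ordered product `y_0^{s_0} y_1^{s_1} ⋯ y_{q-1}^{s_{q-1}}`. -/
def orderedWord (y : ℕ → A) (q : ℕ) (s : ℕ → ℕ) : A :=
  ((List.range q).map fun j => y j ^ s j).prod

theorem orderedWord_zero (y : ℕ → A) (s : ℕ → ℕ) : orderedWord y 0 s = 1 := by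
  simp [orderedWord]

theorem orderedWord_succ (y : ℕ → A) (q : ℕ) (s : ℕ → ℕ) :
    orderedWord y (q + 1) s = orderedWord y q s * y q ^ s q := by
  simp [orderedWord, List.range_succ]

theorem orderedWord_congr (y : ℕ → A) {q : ℕ} {s s' : ℕ → ℕ} (h : ∀ j < q, s j = s' j) :
    orderedWord y q s = orderedWord y q s' := by
  induction q with
  | zero => rw [orderedWord_zero, orderedWord_zero]
  | succ q ih =>
    rw [orderedWord_succ, orderedWord_succ, ih fun j hj => h j (by omega), h q (by omega)]

theorem orderedWord_eq_of_le (y : ℕ → A) {q N : ℕ} (hq : q ≤ N) {s : ℕ → ℕ}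
    (h : ∀ j, q ≤ j → s j = 0) : orderedWord y N s = orderedWord y q s := by
  induction N, hq using Nat.le_induction with
  | base => rfl
  | succ N hN ih => rw [orderedWord_succ, h N hN, pow_zero, mul_one, ih]

theorem commute_orderedWord {y : ℕ → A} {q : ℕ} {a : A} (h : ∀ j < q, Commute a (y j))
    (s : ℕ → ℕ) : Commute a (orderedWord y q s) := by
  induction q with
  | zero => rw [orderedWord_zero]; exact Commute.one_right a
  | succ q ih =>
    rw [orderedWord_succ]
    exact (ih fun j hj => h j (by omega)).mul_right ((h q (by omega)).pow_right _)

theorem orderedWord_add {y : ℕ → A} {q : ℕ} (h : ∀ i < q, ∀ j < q, Commute (y i) (y j))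
    (s s' : ℕ → ℕ) : orderedWord y q (s + s') = orderedWord y q s * orderedWord y q s' := by
  induction q with
  | zero => simp only [orderedWord_zero, mul_one]
  | succ q ih =>
    rw [orderedWord_succ, orderedWord_succ, orderedWord_succ,
      ih fun i hi j hj => h i (by omega) j (by omega), Pi.add_apply, pow_add]
    have := (commute_orderedWord (a := y q) (q := q) (y := y)
      (fun j hj => h q (by omega) j (by omega)) s').pow_left (s q)
    rw [mul_assoc, mul_assoc, ← mul_assoc (orderedWord y q s'), ← this.eq, mul_assoc]

theorem orderedWord_add_single_zero (y : ℕ → A) {q : ℕ} (hq : 0 < q) (s : ℕ →₀ ℕ) :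
    orderedWord y q (s + Finsupp.single 0 1 : ℕ →₀ ℕ) = y 0 * orderedWord y q s := by
  induction q, hq using Nat.le_induction with
  | base => simp [orderedWord, pow_add, (Commute.self_pow (y 0) (s 0)).eq]
  | succ q hq ih =>
    rw [orderedWord_succ, ih, orderedWord_succ, mul_assoc, Finsupp.add_apply,
      Finsupp.single_eq_of_ne (by omega), add_zero]

variable [Algebra f A]

variable (f) in
/-- The linear map that sends each monomial to the corresponding ordered product. -/
def orderedEval (y : ℕ → A) (N : ℕ) : MvPolynomial ℕ f →ₗ[f] A :=
  (basisMonomials ℕ f).constr f fun s => orderedWord y N s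

theorem orderedEval_monomial_one (y : ℕ → A) (N : ℕ) (s : ℕ →₀ ℕ) :
    orderedEval f y N (monomial s 1) = orderedWord y N s := by
  have := (basisMonomials ℕ f).constr_basis f (fun s => orderedWord y N s) s
  rwa [coe_basisMonomials] at this

theorem orderedEval_monomial (y : ℕ → A) (N : ℕ) (s : ℕ →₀ ℕ) (c : f) :
    orderedEval f y N (monomial s c) = c • orderedWord y N s := by
  rw [← orderedEval_monomial_one (f := f), ← map_smul, smul_monomial, smul_eq_mul, mul_one]

theorem linearMap_eq_of_mem_supported {σ M : Type*} [AddCommGroup M] [Module f M] {S : Set σ}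
    (φ ψ : MvPolynomial σ f →ₗ[f] M)
    (h : ∀ s : σ →₀ ℕ, (∀ j ∉ S, s j = 0) → φ (monomial s 1) = ψ (monomial s 1))
    {g : MvPolynomial σ f} (hg : g ∈ supported f S) : φ g = ψ g := by
  rw [g.as_sum, map_sum, map_sum]
  refine Finset.sum_congr rfl fun s hs => ?_
  have : monomial s (coeff s g) = coeff s g • monomial s (1 : f) := by
    rw [smul_monomial, smul_eq_mul, mul_one]
  rw [this, map_smul, map_smul, h s fun j hj => ?_]
  exact mem_support_notMem_vars_zero hs fun h => hj (mem_supported.mp hg h)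

/-- The relations `[y_i, y_j] = (i - j) y_{i+j-n}` between the elements `y_i = l_{n-i}`, `i < N`. -/
structure WittRelations (f : Type*) [Field f] [Algebra f A] (y : ℕ → A) (n N : ℕ) : Prop where
  le : N ≤ n
  mul_comm_add : ∀ i < N, ∀ j < N,
    y i * y j = y j * y i + if n ≤ i + j then ((i : f) - j) • y (i + j - n) else 0

section Relations

variable {y : ℕ → A} {n N : ℕ}

theorem WittRelations.commute (hy : WittRelations f y n N) {i j : ℕ} (hi : i < N) (hj : j < N)
    (h : i + j < n ∨ i = j) : Commute (y i) (y j) := by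
  rcases h with h | rfl
  · rw [commute_iff_eq, hy.mul_comm_add i hi j hj, if_neg (by omega), add_zero]
  · exact Commute.refl _

theorem orderedEval_C (y : ℕ → A) (N : ℕ) (c : f) :
    orderedEval f y N (C c) = algebraMap f A c := by
  rw [← monomial_zero', orderedEval_monomial, orderedWord_eq_of_le y (Nat.zero_le N) (by simp),
    orderedWord_zero, Algebra.smul_def, mul_one]

theorem orderedEval_X (y : ℕ → A) {j : ℕ} (hj : j < N) : orderedEval f y N (X j) = y j := by
  rw [X, orderedEval_monomial_one, orderedWord_eq_of_le y (q := j + 1) hj, orderedWord_succ,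
    orderedWord_congr y (s' := 0), Finsupp.single_eq_same, pow_one]
  · have := orderedWord_eq_of_le y (Nat.zero_le j) (s := 0) (by simp)
    rw [this, orderedWord_zero, one_mul]
  · intro i hi; rw [Finsupp.single_eq_of_ne (by omega)]; rfl
  · intro i hi; rw [Finsupp.single_eq_of_ne (by omega)]

theorem orderedEval_mul_X_pow (y : ℕ → A) {q : ℕ} (hq : q < N) (r : ℕ) {g : MvPolynomial ℕ f}
    (hg : g ∈ supported f {j | j ≤ q}) :
    orderedEval f y N (g * X q ^ r) = orderedEval f y N g * y q ^ r := by
  refine linearMap_eq_of_mem_supported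
    ((orderedEval f y N).comp (LinearMap.mulRight f (X q ^ r)))
    ((LinearMap.mulRight f (y q ^ r)).comp (orderedEval f y N)) (fun s hs => ?_) hg
  have hs' (j : ℕ) (hj : q + 1 ≤ j) : s j = 0 := hs j (by simp; omega)
  rw [LinearMap.comp_apply, LinearMap.comp_apply, LinearMap.mulRight_apply,
    LinearMap.mulRight_apply, X_pow_eq_monomial, monomial_mul, one_mul, orderedEval_monomial_one,
    orderedEval_monomial_one, orderedWord_eq_of_le y hq, orderedWord_eq_of_le y hq hs',
    orderedWord_succ, orderedWord_succ, mul_assoc, ← pow_add, orderedWord_congr y (s' := s)]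
  · simp
  · intro j hj; simp [hj.ne']
  · intro j hj; simp [hs' j hj, show j ≠ q by omega]

/-- No commutation is needed: `y_0` is the first letter of every ordered word. -/
theorem orderedEval_X_zero_mul (y : ℕ → A) (hN : 0 < N) (g : MvPolynomial ℕ f) :
    orderedEval f y N (X 0 * g) = y 0 * orderedEval f y N g := by
  refine linearMap_eq_of_mem_supported (S := Set.univ)
    ((orderedEval f y N).comp (LinearMap.mulLeft f (X 0)))
    ((LinearMap.mulLeft f (y 0)).comp (orderedEval f y N)) (fun s _ => ?_)
    (by rw [supported_univ]; trivial)
  rw [LinearMap.comp_apply, LinearMap.comp_apply, LinearMap.mulLeft_apply,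
    LinearMap.mulLeft_apply, X, monomial_mul, one_mul, orderedEval_monomial_one,
    orderedEval_monomial_one, add_comm, orderedWord_add_single_zero y hN]

/-- The commutator with `y_q` is a derivation, and it sends `y_j`, `j < q`, to a multiple of
`y_{q+j-n}` or to `0`; here `q + j - n < q` because `j < n`. -/
theorem WittRelations.mul_sub_mem (hy : WittRelations f y n N) {q : ℕ} (hq : q < N) {b : A}
    (hb : b ∈ Algebra.adjoin f (y '' {j | j < q})) :
    y q * b - b * y q ∈ Algebra.adjoin f (y '' {j | j < q}) := by
  induction hb using Algebra.adjoin_induction with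
  | mem b hb =>
    obtain ⟨j, hj, rfl⟩ := hb
    rw [Set.mem_ofPred_eq] at hj
    rw [hy.mul_comm_add q hq j (by omega), add_sub_cancel_left]
    split_ifs
    · have hN := hy.le
      have hlt : q + j - n < q := by omega
      have hm : y (q + j - n) ∈ Algebra.adjoin f (y '' {j | j < q}) :=
        Algebra.subset_adjoin ⟨q + j - n, hlt, rfl⟩
      exact Subalgebra.smul_mem _ hm _
    · exact zero_mem _
  | algebraMap c => rw [Algebra.commutes, sub_self]; exact zero_mem _
  | add a b _ _ ha hb => rw [mul_add, add_mul, add_sub_add_comm]; exact add_mem ha hb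
  | mul a b ha' hb' ha hb =>
    have : y q * (a * b) - a * b * y q = (y q * a - a * y q) * b + a * (y q * b - b * y q) := by
      noncomm_ring
    rw [this]
    exact add_mem (mul_mem ha hb') (mul_mem ha' hb)

/-- The spanning half of Poincaré–Birkhoff–Witt. If `B` is generated by the `y_j` with `j < q`, the
span `M` of the `b * y_q ^ r`, `b ∈ B`, is stable under left multiplication by `y_q`, because `y_q b
= b y_q + [y_q, b]` with `[y_q, b] ∈ B`. -/
theorem WittRelations.exists_orderedEval_eq (hy : WittRelations f y n N) {q : ℕ} (hq : q ≤ N)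
    {u : A} (hu : u ∈ Algebra.adjoin f (y '' {j | j < q})) :
    ∃ g ∈ supported f {j | j < q}, orderedEval f y N g = u := by
  induction q generalizing u with
  | zero =>
    have : y '' {j | j < 0} = ∅ := by simp
    rw [this, Algebra.adjoin_empty, Algebra.mem_bot] at hu
    obtain ⟨c, rfl⟩ := hu
    exact ⟨C c, Subalgebra.algebraMap_mem _ c, orderedEval_C y N c⟩
  | succ q ih =>
    set B := Algebra.adjoin f (y '' {j | j < q}) with hB
    set M : Submodule f A := Submodule.span f {v | ∃ b ∈ B, ∃ r : ℕ, v = b * y q ^ r} with hM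
    have hmem {b : A} (hb : b ∈ B) (r : ℕ) : b * y q ^ r ∈ M :=
      Submodule.subset_span ⟨b, hb, r, rfl⟩
    have hgen (j : ℕ) (hj : j < q + 1) (v : A) (hv : v ∈ M) : y j * v ∈ M := by
      induction hv using Submodule.span_induction with
      | mem v hv =>
        obtain ⟨b, hb, r, rfl⟩ := hv
        rcases (Nat.lt_succ_iff.mp hj).lt_or_eq with h | rfl
        · rw [← mul_assoc]
          exact hmem (mul_mem (Algebra.subset_adjoin ⟨j, h, rfl⟩) hb) r
        · have : y j * (b * y j ^ r) = b * y j ^ (r + 1) + (y j * b - b * y j) * y j ^ r := by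
            rw [pow_succ']; noncomm_ring
          rw [this]
          exact add_mem (hmem hb _) (hmem (hy.mul_sub_mem (by omega) hb) r)
      | zero => rw [mul_zero]; exact zero_mem _
      | add v w _ _ hv hw => rw [mul_add]; exact add_mem hv hw
      | smul c v _ hv => rw [mul_smul_comm]; exact Submodule.smul_mem _ c hv
    have hadj (v : A) (hv : v ∈ M) : u * v ∈ M := by
      induction hu using Algebra.adjoin_induction generalizing v with
      | mem u hu =>
        obtain ⟨j, hj, rfl⟩ := hu
        exact hgen j hj v hv
      | algebraMap c => rw [← Algebra.smul_def]; exact Submodule.smul_mem _ c hv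
      | add a b _ _ ha hb => rw [add_mul]; exact add_mem (ha v hv) (hb v hv)
      | mul a b _ _ ha hb => rw [mul_assoc]; exact ha _ (hb v hv)
    have huM : u ∈ M := by
      have := hadj _ (hmem (one_mem B) 0)
      rwa [pow_zero, mul_one, mul_one] at this
    have hle : M ≤ (Subalgebra.toSubmodule (supported f {j | j < q + 1})).map
        (orderedEval f y N) := by
      rw [hM, Submodule.span_le]
      rintro _ ⟨b, hb, r, rfl⟩
      obtain ⟨g, hg, rfl⟩ := ih (by omega) hb
      have hg' : g ∈ supported f {j | j < q + 1} :=
        supported_mono (fun j hj => by simp at hj ⊢; omega) hg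
      have hX : g * X q ^ r ∈ supported f {j | j < q + 1} :=
        mul_mem hg' (pow_mem (X_mem_supported.mpr (by simp)) _)
      refine ⟨g * X q ^ r, hX, ?_⟩
      exact orderedEval_mul_X_pow y (by omega) r
        (supported_mono (fun j hj => by simp at hj ⊢; omega) hg)
    obtain ⟨g, hg, h⟩ := hle huM
    exact ⟨g, hg, h⟩

/-- For `i, j ≤ h` either `i + j < n` or `i = j = h`, so the `y_j` with `j ≤ h` commute. -/
theorem WittRelations.orderedEval_mul (hy : WittRelations f y n N) {h : ℕ} (hn : 2 * h ≤ n)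
    (hN : h < N) {a b : MvPolynomial ℕ f} (ha : a ∈ supported f {j | j ≤ h})
    (hb : b ∈ supported f {j | j ≤ h}) :
    orderedEval f y N (a * b) = orderedEval f y N a * orderedEval f y N b := by
  refine linearMap_eq_of_mem_supported
    ((orderedEval f y N).comp (LinearMap.mulRight f b))
    ((LinearMap.mulRight f (orderedEval f y N b)).comp (orderedEval f y N)) (fun s hs => ?_) ha
  refine linearMap_eq_of_mem_supported
    ((orderedEval f y N).comp (LinearMap.mulLeft f (monomial s 1)))
    ((LinearMap.mulLeft f (orderedEval f y N (monomial s 1))).comp (orderedEval f y N))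
    (fun s' hs' => ?_) hb
  have h1 (j : ℕ) (hj : h + 1 ≤ j) : s j = 0 := hs j (by simp; omega)
  have h2 (j : ℕ) (hj : h + 1 ≤ j) : s' j = 0 := hs' j (by simp; omega)
  rw [LinearMap.comp_apply, LinearMap.comp_apply, LinearMap.mulLeft_apply,
    LinearMap.mulLeft_apply, monomial_mul, one_mul, orderedEval_monomial_one,
    orderedEval_monomial_one, orderedEval_monomial_one, orderedWord_eq_of_le y hN,
    orderedWord_eq_of_le y hN h1, orderedWord_eq_of_le y hN h2, Finsupp.coe_add, orderedWord_add]
  · intro i hi j hj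
    exact hy.commute (by omega) (by omega) (by omega)
  · intro j hj
    simp [h1 j hj, h2 j hj]

/-- Leibniz rule for `[y_{n-q}, y_q] = (n - 2q) y_0`, as `y_0` commutes with `y_q`. For `r = 0` the
truncated exponent is harmless, since the coefficient vanishes. -/
theorem WittRelations.mul_pow_sub (hy : WittRelations f y n N) {q : ℕ} (hq : q < N)
    (hnq : n - q < N) (r : ℕ) :
    y (n - q) * y q ^ r - y q ^ r * y (n - q) =
      (r * ((n : f) - 2 * q)) • (y 0 * y q ^ (r - 1)) := by
  have hN := hy.le
  induction r with
  | zero => simp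
  | succ r ih =>
    have h0 : Commute (y q) (y 0) := hy.commute hq (by omega) (by omega)
    have h1 := hy.mul_comm_add (n - q) hnq q hq
    rw [if_pos (by omega), show n - q + q - n = 0 by omega, Nat.cast_sub (by omega)] at h1
    have h2 : y (n - q) * y q ^ (r + 1) - y q ^ (r + 1) * y (n - q) =
        (y (n - q) * y q ^ r - y q ^ r * y (n - q)) * y q +
          y q ^ r * (y (n - q) * y q - y q * y (n - q)) := by
      rw [pow_succ]; noncomm_ring
    rw [h2, ih, h1, add_sub_cancel_left, mul_smul_comm, ((h0.pow_left r).eq), smul_mul_assoc,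
      Nat.add_sub_cancel]
    rcases r with _ | r
    · simp; ring_nf
    · rw [Nat.add_sub_cancel, mul_assoc, ← pow_succ, ← add_smul]
      congr 1
      push_cast; ring

theorem WittRelations.mul_orderedWord_sub (hy : WittRelations f y n N) {q : ℕ} (hq : q < N)
    (hnq : n - q < N) {s : ℕ →₀ ℕ} (hs : ∀ j, q + 1 ≤ j → s j = 0) :
    y (n - q) * orderedWord y N s - orderedWord y N s * y (n - q) =
      ((s q : f) * ((n : f) - 2 * q)) • (y 0 * orderedWord y N (s - Finsupp.single q 1 : ℕ →₀ ℕ)) := by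
  have hN := hy.le
  have e1 : orderedWord y N (s - Finsupp.single q 1 : ℕ →₀ ℕ) = orderedWord y q s * y q ^ (s q - 1) := by
    rw [orderedWord_eq_of_le y hq, orderedWord_succ,
      orderedWord_congr y (s := (s - Finsupp.single q 1 : ℕ →₀ ℕ)) (s' := s)]
    · simp
    · intro j hj; simp [hj.ne]
    · intro j hj; simp [hs j hj]
  rw [e1, orderedWord_eq_of_le y hq hs, orderedWord_succ]
  have h1 : Commute (y (n - q)) (orderedWord y q s) :=
    commute_orderedWord (fun j hj => hy.commute hnq (by omega) (by omega)) s
  have h2 : Commute (y 0) (orderedWord y q s) :=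
    commute_orderedWord (fun j hj => hy.commute (by omega) (by omega) (by omega)) s
  have h3 : y (n - q) * (orderedWord y q s * y q ^ s q) -
      orderedWord y q s * y q ^ s q * y (n - q) =
        orderedWord y q s * (y (n - q) * y q ^ s q - y q ^ s q * y (n - q)) := by
    rw [← mul_assoc, h1.eq]; noncomm_ring
  rw [h3, hy.mul_pow_sub hq hnq, mul_smul_comm, ← mul_assoc, ← h2.eq, mul_assoc]

theorem WittRelations.mul_orderedEval_sub (hy : WittRelations f y n N) {q : ℕ} (hq : q < N)
    (hnq : n - q < N) {g : MvPolynomial ℕ f} (hg : g ∈ supported f {j | j ≤ q}) :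
    y (n - q) * orderedEval f y N g - orderedEval f y N g * y (n - q) =
      ((n : f) - 2 * q) • (y 0 * orderedEval f y N (pderiv q g)) := by
  have key := linearMap_eq_of_mem_supported
    ((LinearMap.mulLeft f (y (n - q)) - LinearMap.mulRight f (y (n - q))) ∘ₗ orderedEval f y N)
    (((n : f) - 2 * q) • (LinearMap.mulLeft f (y 0) ∘ₗ orderedEval f y N ∘ₗ
      (pderiv q : Derivation f (MvPolynomial ℕ f) (MvPolynomial ℕ f)).toLinearMap))
    (fun s hs => ?_) hg
  · simpa only [LinearMap.comp_apply, LinearMap.sub_apply, LinearMap.mulLeft_apply,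
      LinearMap.mulRight_apply, LinearMap.smul_apply, Derivation.coeFn_coe] using key
  · simp only [LinearMap.comp_apply, LinearMap.sub_apply, LinearMap.mulLeft_apply,
      LinearMap.mulRight_apply, LinearMap.smul_apply, Derivation.coeFn_coe]
    rw [orderedEval_monomial_one, hy.mul_orderedWord_sub hq hnq fun j hj => hs j (by simp; omega),
      pderiv_monomial, orderedEval_monomial, one_mul, mul_smul_comm, smul_smul, mul_comm]

/-- Evaluation is multiplicative on `f[x_0, …, x_h]`, so both sides obey the Leibniz rule and it
suffices to compare them on the variables. -/
theorem WittRelations.mul_orderedEval_sub_eq_shiftDerivation (hy : WittRelations f y n N)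
    {h i : ℕ} (hn : n = 2 * h) (hi : h + i < N) (hih : i ≤ h)
    {g : MvPolynomial ℕ f} (hg : g ∈ supported f {j | j ≤ h}) :
    shiftDerivation f h i g ∈ supported f {j | j ≤ h} ∧
    y (h + i) * orderedEval f y N g - orderedEval f y N g * y (h + i) =
      orderedEval f y N (shiftDerivation f h i g) := by
  rw [supported_eq_adjoin_X] at hg
  induction hg using Algebra.adjoin_induction with
  | mem g hg =>
    obtain ⟨j, hj, rfl⟩ := hg
    rw [Set.mem_ofPred_eq] at hj
    have h1 : shiftDerivation f h i (X j) =
        if n ≤ h + i + j then ((h + i : ℕ) - j : f) • X (h + i + j - n) else 0 := by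
      rw [shiftDerivation_apply]
      split_ifs with h2
      -- With `p = i + j - h`, the weight `2i - p` is `(h + i) - j`, the structure constant of
      -- `[y_{h+i}, y_j]`.
      · rw [Finset.sum_eq_single (h + i + j - n)]
        · rw [show h - i + (h + i + j - n) = j by omega, pderiv_X_self, mul_one, Algebra.smul_def]
          congr 1
          have h3 : (2 * (i : f) - ((h + i + j - n : ℕ) : f)) = (h + i : ℕ) - j := by
            rw [Nat.cast_sub h2, hn]; push_cast; ring
          rw [← h3, algebraMap_eq, map_sub, map_mul, map_natCast, map_natCast, map_ofNat]
        · intro p _ hp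
          rw [pderiv_X_of_ne (by omega), mul_zero]
        · intro hp
          rw [Finset.mem_range] at hp
          omega
      · refine Finset.sum_eq_zero fun p _ => ?_
        rw [pderiv_X_of_ne (by omega), mul_zero]
    rw [h1, orderedEval_X y (by omega), hy.mul_comm_add _ hi j (by omega), add_sub_cancel_left]
    split_ifs with h2
    · refine ⟨Subalgebra.smul_mem _ (X_mem_supported.mpr (by simp; omega)) _, ?_⟩
      rw [map_smul, orderedEval_X y (by omega)]
    · exact ⟨zero_mem _, (map_zero _).symm⟩
  | algebraMap c =>
    rw [Derivation.map_algebraMap]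
    refine ⟨zero_mem _, ?_⟩
    rw [algebraMap_eq, orderedEval_C, Algebra.commutes, sub_self, map_zero]
  | add a b _ _ ha hb =>
    refine ⟨by rw [map_add]; exact add_mem ha.1 hb.1, ?_⟩
    rw [map_add, map_add, map_add, ← ha.2, ← hb.2]; noncomm_ring
  | mul a b ha' hb' ha hb =>
    rw [← supported_eq_adjoin_X] at ha' hb'
    rw [Derivation.leibniz, smul_eq_mul, smul_eq_mul]
    refine ⟨add_mem (mul_mem ha' hb.1) (mul_mem hb' ha.1), ?_⟩
    have hmul {a b : MvPolynomial ℕ f} (ha : a ∈ supported f {j | j ≤ h})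
      (hb : b ∈ supported f {j | j ≤ h}) := hy.orderedEval_mul (by omega) (by omega) ha hb
    rw [map_add, hmul ha' hb', hmul ha' hb.1, mul_comm b, hmul ha.1 hb', ← ha.2, ← hb.2]
    noncomm_ring

end Relations

/-! ### Independence of ordered monomials by a leading-term argument -/

section Degree

variable {f : Type*} [Field f]

variable (f) in
/-- The polynomials of total degree less than `d`. -/
def degreeLT (d : ℕ) : Submodule f (MvPolynomial ℕ f) where
  carrier := {p | ∀ s : ℕ →₀ ℕ, d ≤ s.degree → coeff s p = 0}
  add_mem' := fun ha hb s hs => by rw [coeff_add, ha s hs, hb s hs, add_zero]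
  zero_mem' := fun s _ => coeff_zero s
  smul_mem' := fun c p hp s hs => by rw [coeff_smul, hp s hs, smul_zero]

theorem degreeLT_mono {d e : ℕ} (h : d ≤ e) : degreeLT f d ≤ degreeLT f e :=
  fun _ hp s hs => hp s (h.trans hs)

theorem mul_mem_degreeLT {d e c : ℕ} (h : d + e ≤ c + 1) {p q : MvPolynomial ℕ f}
    (hp : p ∈ degreeLT f d) (hq : q ∈ degreeLT f e) : p * q ∈ degreeLT f c := by
  classical
  intro s hs
  rw [coeff_mul]
  refine Finset.sum_eq_zero fun a ha => ?_
  have h1 : a.1.degree + a.2.degree = s.degree := by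
    rw [← map_add, Finset.HasAntidiagonal.mem_antidiagonal.mp ha]
  rcases le_or_gt d a.1.degree with h2 | h2
  · rw [hp _ h2, zero_mul]
  · rw [hq _ (by omega), mul_zero]

theorem monomial_mem_degreeLT {s : ℕ →₀ ℕ} {d : ℕ} (h : s.degree < d) (c : f) :
    monomial s c ∈ degreeLT f d := by
  classical
  intro s' hs
  rw [coeff_monomial, if_neg]
  rintro rfl
  omega

theorem X_mem_degreeLT (j : ℕ) : (X j : MvPolynomial ℕ f) ∈ degreeLT f 2 :=
  monomial_mem_degreeLT (by simp) 1

theorem derivation_mem_degreeLT {D : Derivation f (MvPolynomial ℕ f) (MvPolynomial ℕ f)}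
    (hD : ∀ k, D (X k) ∈ degreeLT f 2) {d : ℕ} {p : MvPolynomial ℕ f} (hp : p ∈ degreeLT f d) :
    D p ∈ degreeLT f d := by
  rw [p.as_sum, map_sum]
  refine sum_mem fun s hs => ?_
  have hsd : s.degree < d := by
    by_contra h
    exact mem_support_iff.mp hs (hp s (not_lt.mp h))
  have h1 : D = mkDerivation f fun k => D (X k) := derivation_ext fun k => by rw [mkDerivation_X]
  rw [h1, mkDerivation_monomial, Finsupp.sum]
  refine Submodule.smul_mem _ _ (Submodule.sum_mem _ fun k hk => ?_)
  have h2 : Finsupp.single k 1 ≤ s :=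
    Finsupp.single_le_iff.mpr (Nat.one_le_iff_ne_zero.mpr (Finsupp.mem_support_iff.mp hk))
  have h3 : (s - Finsupp.single k 1).degree + 1 = s.degree := by
    have := congrArg Finsupp.degree (tsub_add_cancel_of_le h2)
    rwa [map_add, Finsupp.degree_single] at this
  rw [smul_eq_mul]
  exact mul_mem_degreeLT (by omega) (monomial_mem_degreeLT (Nat.lt_succ_self _) _) (hD k)

variable {A : Type*} [Ring A] [Algebra f A] {y : ℕ → A} {N : ℕ}
  {T : A →ₐ[f] Module.End f (MvPolynomial ℕ f)}
  {D : ℕ → Derivation f (MvPolynomial ℕ f) (MvPolynomial ℕ f)}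

/-- Multiplication by `x_j` raises the degree by one and `D_j` does not raise it, so the leading
part of `y_j ^ a * u` applied to `1` is `x_j ^ a` times that of `u`. -/
theorem pow_mul_apply_one_sub_mem (hD : ∀ j k, D j (X k) ∈ degreeLT f 2)
    (hT : ∀ j < N, ∀ p, T (y j) p = X j * p + D j p) {j : ℕ} (hj : j < N) {u : A}
    {p : MvPolynomial ℕ f} {d : ℕ} (hp : p ∈ degreeLT f (d + 1))
    (hu : T u 1 - p ∈ degreeLT f d) (a : ℕ) :
    X j ^ a * p ∈ degreeLT f (a + d + 1) ∧
      T (y j ^ a * u) 1 - X j ^ a * p ∈ degreeLT f (a + d) := by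
  induction a with
  | zero => simpa using ⟨hp, hu⟩
  | succ a ih =>
    obtain ⟨h1, h2⟩ := ih
    rw [pow_succ', pow_succ', mul_assoc, mul_assoc]
    refine ⟨mul_mem_degreeLT (by omega) (X_mem_degreeLT j) h1, ?_⟩
    rw [map_mul, Module.End.mul_apply, hT j hj]
    have h3 : X j * T (y j ^ a * u) 1 + D j (T (y j ^ a * u) 1) - X j * (X j ^ a * p) =
        X j * (T (y j ^ a * u) 1 - X j ^ a * p) + (D j (T (y j ^ a * u) 1 - X j ^ a * p) +
          D j (X j ^ a * p)) := by
      rw [map_sub]; ring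
    rw [h3]
    refine add_mem (mul_mem_degreeLT (by omega) (X_mem_degreeLT j) h2) (add_mem ?_ ?_)
    · exact degreeLT_mono (by omega) (derivation_mem_degreeLT (hD j) h2)
    · exact degreeLT_mono (by omega) (derivation_mem_degreeLT (hD j) h1)

theorem list_prod_apply_one_sub_mem (hD : ∀ j k, D j (X k) ∈ degreeLT f 2)
    (hT : ∀ j < N, ∀ p, T (y j) p = X j * p + D j p) (s : ℕ → ℕ) (ℓ : List ℕ)
    (hℓ : ∀ j ∈ ℓ, j < N) :
    (ℓ.map fun j => (X j : MvPolynomial ℕ f) ^ s j).prod ∈ degreeLT f ((ℓ.map s).sum + 1) ∧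
      T (ℓ.map fun j => y j ^ s j).prod 1 - (ℓ.map fun j => X j ^ s j).prod ∈
        degreeLT f (ℓ.map s).sum := by
  induction ℓ with
  | nil =>
    simp only [List.map_nil, List.prod_nil, List.sum_nil, map_one, Module.End.one_apply, sub_self]
    exact ⟨monomial_mem_degreeLT (by simp) 1, zero_mem _⟩
  | cons j ℓ ih =>
    obtain ⟨h1, h2⟩ := ih fun i hi => hℓ i (List.mem_cons_of_mem _ hi)
    simp only [List.map_cons, List.prod_cons, List.sum_cons]
    exact pow_mul_apply_one_sub_mem hD hT (hℓ j List.mem_cons_self) h1 h2 _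

theorem orderedWord_X_eq_monomial {s : ℕ →₀ ℕ} (hs : ∀ j, N ≤ j → s j = 0) :
    orderedWord (fun j => (X j : MvPolynomial ℕ f)) N s = monomial s 1 := by
  have h (q : ℕ) : orderedWord (fun j => (X j : MvPolynomial ℕ f)) q s =
      ∏ j ∈ Finset.range q, X j ^ s j := by
    induction q with
    | zero => rw [orderedWord_zero, Finset.prod_range_zero]
    | succ q ih => rw [orderedWord_succ, ih, Finset.prod_range_succ]
  rw [h, monomial_eq, C_1, one_mul, Finsupp.prod_of_support_subset]
  · intro j hj
    rw [Finset.mem_range]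
    by_contra h
    exact Finsupp.mem_support_iff.mp hj (hs j (not_lt.mp h))
  · exact fun _ _ => pow_zero _

theorem sum_range_map_eq_degree {s : ℕ →₀ ℕ} (hs : ∀ j, N ≤ j → s j = 0) :
    ((List.range N).map s).sum = s.degree := by
  have h (q : ℕ) : ((List.range q).map s).sum = ∑ j ∈ Finset.range q, s j := by
    induction q with
    | zero => simp
    | succ q ih => simp [List.range_succ, Finset.sum_range_succ, ih]
  rw [h, Finsupp.degree_apply]
  refine (Finset.sum_subset ?_ ?_).symm
  · intro j hj
    rw [Finset.mem_range]
    by_contra h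
    exact Finsupp.mem_support_iff.mp hj (hs j (not_lt.mp h))
  · exact fun j _ hj => Finsupp.notMem_support_iff.mp hj

/-- Applied to `1`, the ordered value of `g` agrees with `g` up to terms of degree below the total
degree of `g`; a top-degree coefficient of a nonzero `g` would survive. -/
theorem eq_zero_of_orderedEval_eq_zero (hD : ∀ j k, D j (X k) ∈ degreeLT f 2)
    (hT : ∀ j < N, ∀ p, T (y j) p = X j * p + D j p) {g : MvPolynomial ℕ f}
    (hg : g ∈ supported f {j | j < N}) (h : orderedEval f y N g = 0) : g = 0 := by
  by_contra hg0
  obtain ⟨s, hs, hmax⟩ := g.support.exists_max_image Finsupp.degree (support_nonempty.mpr hg0)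
  have key : T (orderedEval f y N g) 1 - g ∈ degreeLT f s.degree := by
    have h1 : T (orderedEval f y N g) 1 - g = ∑ s ∈ g.support,
        coeff s g • (T (orderedWord y N s) 1 - monomial s 1) := by
      have h2 : orderedEval f y N g = ∑ s ∈ g.support, coeff s g • orderedWord y N s := by
        conv_lhs => rw [g.as_sum, map_sum]
        exact Finset.sum_congr rfl fun s _ => orderedEval_monomial y N s _
      have h3 : g = ∑ s ∈ g.support, coeff s g • monomial s 1 := by
        conv_lhs => rw [g.as_sum]
        exact Finset.sum_congr rfl fun s _ => by rw [smul_monomial, smul_eq_mul, mul_one]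
      simp only [smul_sub, Finset.sum_sub_distrib]
      rw [← h3, h2, map_sum, LinearMap.sum_apply]
      simp only [map_smul, LinearMap.smul_apply]
    rw [h1]
    refine sum_mem fun s' hs' => Submodule.smul_mem _ _ ?_
    have h4 (j : ℕ) (hj : N ≤ j) : s' j = 0 :=
      mem_support_notMem_vars_zero hs' fun h => absurd (mem_supported.mp hg h) (by simp [hj])
    have h5 := (list_prod_apply_one_sub_mem hD hT s' (List.range N)
      fun j hj => List.mem_range.mp hj).2
    rw [sum_range_map_eq_degree h4] at h5
    have h6 := orderedWord_X_eq_monomial (f := f) h4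
    rw [orderedWord] at h6
    rw [h6] at h5
    exact degreeLT_mono (hmax s' hs') h5
  have := key s le_rfl
  rw [h, map_zero, LinearMap.zero_apply, zero_sub, coeff_neg, neg_eq_zero] at this
  exact mem_support_iff.mp hs this

end Degree

/-! ### The center in terms of the Witt relations -/

section Center

variable {f : Type*} [Field f] {A : Type*} [Ring A] [Algebra f A] {y : ℕ → A} {n N : ℕ}

theorem mem_center_of_commute (hgen : Algebra.adjoin f (y '' {j | j < N}) = ⊤) {u : A}
    (h : ∀ j < N, Commute (y j) u) : u ∈ Subalgebra.center f A := by
  rw [Subalgebra.mem_center_iff]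
  intro b
  have hb : b ∈ Algebra.adjoin f (y '' {j | j < N}) := hgen ▸ Algebra.mem_top
  induction hb using Algebra.adjoin_induction with
  | mem b hb =>
    obtain ⟨j, hj, rfl⟩ := hb
    exact (h j hj).eq
  | algebraMap c => exact Algebra.commutes c u
  | add a b _ _ ha hb => rw [add_mul, mul_add, ha, hb]
  | mul a b _ _ ha hb => rw [mul_assoc, hb, ← mul_assoc, ha, mul_assoc]

theorem WittRelations.mem_center (hy : WittRelations f y n N)
    (hgen : Algebra.adjoin f (y '' {j | j < N}) = ⊤) {j : ℕ} (hj : j < N) (hjN : j + N ≤ n) :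
    y j ∈ Subalgebra.center f A :=
  mem_center_of_commute hgen fun i hi => hy.commute hi hj (by omega)

/-- The variables `x_q`, `q > h`, are removed from the top down using `[y_{n-q}, g] = (n - 2q) y_0
∂g/∂x_q`; `hhN` guarantees that `y_{n-q}` is among the generators. -/
theorem WittRelations.exists_orderedEval_eq_of_mem_center [CharZero f]
    (hy : WittRelations f y n N) (hgen : Algebra.adjoin f (y '' {j | j < N}) = ⊤)
    (hinj : ∀ g ∈ supported f {j | j < N}, orderedEval f y N g = 0 → g = 0)
    {h : ℕ} (hh : h < N) (hhN : n < h + 1 + N) (hn : ∀ q, h < q → q < N → n ≠ 2 * q) {u : A}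
    (hu : u ∈ Subalgebra.center f A) :
    ∃ g ∈ supported f {j | j ≤ h}, orderedEval f y N g = u := by
  obtain ⟨g, hg, rfl⟩ := hy.exists_orderedEval_eq le_rfl
    (hgen ▸ Algebra.mem_top : u ∈ Algebra.adjoin f (y '' {j | j < N}))
  refine ⟨g, ?_, rfl⟩
  have key (d : ℕ) (hd : h + d < N) : g ∈ supported f {j | j ≤ N - 1 - d} := by
    induction d with
    | zero => exact supported_mono (fun j hj => by simp at hj ⊢; omega) hg
    | succ d ih =>
      specialize ih (by omega)
      set q := N - 1 - d with hq
      have h1 := hy.mul_orderedEval_sub (q := q) (by omega) (by omega) ih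
      rw [Subalgebra.mem_center_iff.mp hu, sub_self, eq_comm, ← orderedEval_X_zero_mul y (by omega)]
        at h1
      have h2 : (n : f) - 2 * q ≠ 0 := by
        rw [sub_ne_zero]
        exact_mod_cast hn q (by omega) (by omega)
      have hq' : pderiv q g ∈ supported f {j | j < N} :=
        mem_supported_of_pderiv_eq_zero fun j hj => by
          rw [pderiv_pderiv_comm, pderiv_eq_zero_of_mem_supported hg hj, map_zero]
      have h3 := hinj _ (mul_mem (X_mem_supported.mpr (by simp; omega)) hq')
        ((smul_eq_zero.mp h1).resolve_left h2)
      have h4 := (mul_eq_zero.mp h3).resolve_left (X_ne_zero 0)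
      refine mem_supported_of_pderiv_eq_zero fun j hj => ?_
      rw [Set.mem_ofPred_eq, not_le] at hj
      rcases (show q ≤ j by omega).eq_or_lt with rfl | h5
      · exact h4
      · exact pderiv_eq_zero_of_mem_supported ih (by simpa using h5)
  have := key (N - 1 - h) (by omega)
  rwa [show N - 1 - (N - 1 - h) = h by omega] at this

/-- On `f[x_0, …, x_h]` the evaluation is an injective ring homomorphism, so independence and
generation may be checked among commuting polynomials. -/
theorem WittRelations.centerIsPolynomialAlgebra (hy : WittRelations f y n N)
    (hinj : ∀ g ∈ supported f {j | j < N}, orderedEval f y N g = 0 → g = 0)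
    {h : ℕ} (hh : h < N) (hn : 2 * h ≤ n) {J : Type*} {c : J → MvPolynomial ℕ f}
    (hc : ∀ j, c j ∈ supported f {j | j ≤ h}) (hci : AlgebraicIndependent f c)
    (hcc : ∀ j, orderedEval f y N (c j) ∈ Subalgebra.center f A)
    (hcg : ∀ u ∈ Subalgebra.center f A,
      ∃ g ∈ Algebra.adjoin f (Set.range c), orderedEval f y N g = u) :
    CenterIsPolynomialAlgebra f fun j => orderedEval f y N (c j) := by
  have hle : Algebra.adjoin f (Set.range c) ≤ supported f {j | j ≤ h} := by
    rw [Algebra.adjoin_le_iff]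
    rintro _ ⟨j, rfl⟩
    exact hc j
  refine ⟨⟨hcc, ?_⟩, le_antisymm ?_ ?_⟩
  · rw [algebraicIndependent_iff]
    intro p hp
    have key (p : MvPolynomial J f) : aeval c p ∈ supported f {j | j ≤ h} ∧
        orderedEval f y N (aeval c p) =
          (aeval (fun j => (⟨orderedEval f y N (c j), hcc j⟩ : Subalgebra.center f A)) p : A) := by
      induction p using MvPolynomial.induction_on with
      | C a =>
        rw [aeval_C, aeval_C, algebraMap_eq, orderedEval_C]
        exact ⟨Subalgebra.algebraMap_mem _ a, rfl⟩
      | add p q hp hq =>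
        rw [map_add, map_add, map_add, hp.2, hq.2]
        exact ⟨add_mem hp.1 hq.1, rfl⟩
      | mul_X p j hp =>
        rw [map_mul (aeval c), map_mul (aeval fun j => _) p, aeval_X, aeval_X, hy.orderedEval_mul hn hh hp.1 (hc j), hp.2]
        exact ⟨mul_mem hp.1 (hc j), rfl⟩
    have h1 := (key p).2
    rw [hp] at h1
    exact algebraicIndependent_iff.mp hci p (hinj _
      (supported_mono (fun j hj => by simp at hj ⊢; omega) (key p).1) h1)
  · intro u hu
    obtain ⟨g, hg, rfl⟩ := hcg u hu
    clear hu
    induction hg using Algebra.adjoin_induction with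
    | mem g hg =>
      obtain ⟨j, rfl⟩ := hg
      exact Algebra.subset_adjoin ⟨j, rfl⟩
    | algebraMap a => rw [algebraMap_eq, orderedEval_C]; exact Subalgebra.algebraMap_mem _ a
    | add a b _ _ ha hb => rw [map_add]; exact add_mem ha hb
    | mul a b ha' hb' ha hb =>
      rw [hy.orderedEval_mul hn hh (hle ha') (hle hb')]
      exact mul_mem ha hb
  · rw [Algebra.adjoin_le_iff]
    rintro _ ⟨j, rfl⟩
    exact hcc j

theorem WittRelations.centerIsPolynomialAlgebra_of_odd [CharZero f] {m : ℕ} (hm : 2 * m + 2 ≤ n)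
    (hn : Odd n) (hy : WittRelations f y n (n - m))
    (hgen : Algebra.adjoin f (y '' {j | j < n - m}) = ⊤)
    (hinj : ∀ g ∈ supported f {j | j < n - m}, orderedEval f y (n - m) g = 0 → g = 0) :
    CenterIsPolynomialAlgebra f fun j : Fin (m + 1) => y j := by
  have h := hy.centerIsPolynomialAlgebra hinj (h := m) (by omega) (by omega)
    (c := fun j : Fin (m + 1) => X (j : ℕ)) (fun j => X_mem_supported.mpr (by simp; omega))
    (algebraicIndependent_X_fin m)
    (fun j => by
      rw [orderedEval_X y (by omega)]
      exact hy.mem_center hgen (by omega) (by omega))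
    (fun u hu => by
      rw [← supported_eq_adjoin_range]
      exact hy.exists_orderedEval_eq_of_mem_center hgen hinj (by omega) (by omega)
        (fun q _ _ => by rintro rfl; exact (Nat.not_odd_iff_even.mpr (even_two_mul q)) hn) hu)
  convert h using 2 with j
  rw [orderedEval_X y (by omega)]

theorem WittRelations.centerIsPolynomialAlgebra_of_even [CharZero f] {m k : ℕ} (hk : 1 ≤ k)
    (hn : n = 2 * (m + k)) (hy : WittRelations f y n (n - m))
    (hgen : Algebra.adjoin f (y '' {j | j < n - m}) = ⊤)
    (hinj : ∀ g ∈ supported f {j | j < n - m}, orderedEval f y (n - m) g = 0 → g = 0)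
    {Q : MvPolynomial ℕ f} (hQs : Q ∈ supported f {j | j ≤ m + k})
    (hQ1 : 2 * pderiv (m + k) Q = X 0 ^ (k - 1)) (hQ2 : ¬ X 0 ∣ pderiv (m + 1) Q)
    (hQ3 : ∀ i, 1 ≤ i → i < k → shiftDerivation f (m + k) i Q = 0) :
    CenterIsPolynomialAlgebra f (Fin.snoc (α := fun _ : Fin (m + 2) => A)
      (fun j : Fin (m + 1) => y j) (orderedEval f y (n - m) Q)) := by
  have hX (j : ℕ) (hj : j ≤ m) : y j ∈ Subalgebra.center f A :=
    hy.mem_center hgen (by omega) (by omega)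
  have hQc : orderedEval f y (n - m) Q ∈ Subalgebra.center f A := by
    refine mem_center_of_commute hgen fun j hj => ?_
    -- For `j ≤ m + k` everything lies in the commutative part; for larger `j` the commutator is the
    -- value of `D_{j-(m+k)} Q = 0`.
    rcases le_or_gt j (m + k) with h1 | h1
    · have h2 : (X j : MvPolynomial ℕ f) ∈ supported f {j | j ≤ m + k} := X_mem_supported.mpr h1
      rw [commute_iff_eq, ← orderedEval_X (f := f) y hj,
        ← hy.orderedEval_mul (h := m + k) (by omega) (by omega) h2 hQs,
        ← hy.orderedEval_mul (h := m + k) (by omega) (by omega) hQs h2, mul_comm]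
    · have h2 := (hy.mul_orderedEval_sub_eq_shiftDerivation (h := m + k) (i := j - (m + k)) hn
        (by omega) (by omega) hQs).2
      rwa [hQ3 _ (by omega) (by omega), map_zero, sub_eq_zero,
        show m + k + (j - (m + k)) = j by omega] at h2
  have h := hy.centerIsPolynomialAlgebra hinj (h := m + k) (by omega) (by omega)
    (c := Fin.snoc (α := fun _ : Fin (m + 2) => MvPolynomial ℕ f)
      (fun j : Fin (m + 1) => X (j : ℕ)) Q) (fun j => by
        induction j using Fin.lastCases with
        | last => simpa using hQs
        | cast j =>
          rw [Fin.snoc_castSucc]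
          exact X_mem_supported.mpr (by simp; omega))
    (algebraicIndependent_snoc hQ2)
    (fun j => by
        induction j using Fin.lastCases with
        | last => simpa using hQc
        | cast j =>
          rw [Fin.snoc_castSucc, orderedEval_X y (by omega)]
          exact hX j (by omega))
    (fun u hu => by
      obtain ⟨g, hg, rfl⟩ := hy.exists_orderedEval_eq_of_mem_center hgen hinj
        (h := m + k) (by omega) (by omega) (fun q _ _ => by omega) hu
      refine ⟨g, ?_, rfl⟩
      obtain ⟨B, rfl⟩ := exists_aeval_eq_of_shiftDerivation_eq_zero hk hQs hQ1 hQ2 hQ3 hg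
        fun i hi hik => by
          have h1 := hy.mul_orderedEval_sub_eq_shiftDerivation (h := m + k) (i := i) hn
            (by omega) (by omega) hg
          rw [Subalgebra.mem_center_iff.mp hu, sub_self] at h1
          exact hinj _ (supported_mono (fun j hj => by simp at hj ⊢; omega) h1.1) h1.2.symm
      rw [Polynomial.aeval_eq_sum_range]
      refine sum_mem fun i _ => ?_
      rw [Algebra.smul_def]
      have hQa : Q ∈ Algebra.adjoin f (Set.range
          (Fin.snoc (α := fun _ : Fin (m + 2) => MvPolynomial ℕ f)
            (fun j : Fin (m + 1) => X (j : ℕ)) Q)) :=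
        Algebra.subset_adjoin ⟨Fin.last _, by simp⟩
      refine mul_mem ?_ (pow_mem hQa i)
      have h2 : (supported f {j : ℕ | j ≤ m}) ≤ Algebra.adjoin f
          (Set.range (Fin.snoc (α := fun _ : Fin (m + 2) => MvPolynomial ℕ f)
            (fun j : Fin (m + 1) => X (j : ℕ)) Q)) := by
        rw [supported_eq_adjoin_range]
        refine Algebra.adjoin_mono ?_
        rintro _ ⟨j, rfl⟩
        exact ⟨j.castSucc, by simp⟩
      exact h2 (B.coeff i).2)
  convert h using 1
  funext j
  induction j using Fin.lastCases with
  | last => simp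
  | cast j => rw [Fin.snoc_castSucc, Fin.snoc_castSucc, orderedEval_X y (by omega)]

end Center

attribute [local instance 100] LieRing.ofAssociativeRing

/-! ### The representation on a polynomial ring -/

section Representation

variable {f : Type*} [Field f]

variable (f) in
/-- The linear map `g ↦ ∑_{j ≤ n} g_{n-j+1} x_j`. -/
def linearForm (n : ℕ) : f⟦X⟧ →ₗ[f] MvPolynomial ℕ f :=
  ∑ j ∈ Finset.range (n + 1), (PowerSeries.coeff (n - j + 1)).smulRight (X j)

theorem linearForm_apply (n : ℕ) (g : f⟦X⟧) : linearForm f n g =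
    ∑ j ∈ Finset.range (n + 1), PowerSeries.coeff (n - j + 1) g • X j := by
  rw [linearForm, LinearMap.sum_apply]
  rfl

theorem linearForm_eq_zero {n : ℕ} {g : f⟦X⟧} (h : PowerSeries.X ^ (n + 2) ∣ g) :
    linearForm f n g = 0 := by
  rw [linearForm_apply]
  refine Finset.sum_eq_zero fun j _ => ?_
  rw [PowerSeries.X_pow_dvd_iff.mp h _ (by omega), zero_smul]

theorem linearForm_X_pow {n j : ℕ} (hj : j ≤ n) :
    linearForm f n (PowerSeries.X ^ (n - j + 1)) = X j := by
  rw [linearForm_apply, Finset.sum_eq_single j]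
  · rw [PowerSeries.coeff_X_pow_self, one_smul]
  · intro i hi hij
    rw [Finset.mem_range] at hi
    rw [PowerSeries.coeff_X_pow, if_neg (by omega), zero_smul]
  · intro h
    rw [Finset.mem_range] at h
    omega

theorem linearForm_mem_degreeLT (n : ℕ) (g : f⟦X⟧) : linearForm f n g ∈ degreeLT f 2 := by
  rw [linearForm_apply]
  exact sum_mem fun j _ => Submodule.smul_mem _ _ (X_mem_degreeLT j)

variable (f) in
/-- The derivation of the polynomial ring induced by the action of a vector field on the
quotient `(t) / (t^{n+2})`, whose basis `t^{n-j+1}` corresponds to the variables `x_j`. -/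
def inducedDerivation (n : ℕ) (D : W f) : Derivation f (MvPolynomial ℕ f) (MvPolynomial ℕ f) :=
  mkDerivation f fun j => if j ≤ n then linearForm f n (D (PowerSeries.X ^ (n - j + 1))) else 0

theorem inducedDerivation_X {n j : ℕ} (hj : j ≤ n) (D : W f) :
    inducedDerivation f n D (X j) = linearForm f n (D (PowerSeries.X ^ (n - j + 1))) := by
  rw [inducedDerivation, mkDerivation_X, if_pos hj]

theorem inducedDerivation_X_of_lt {n j : ℕ} (hj : n < j) (D : W f) :
    inducedDerivation f n D (X j) = 0 := by
  rw [inducedDerivation, mkDerivation_X, if_neg (by omega)]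

/-- Modulo `t^{n+2}`, `g` is a constant plus a combination of the `t^{n-j+1}`. Constants are killed
by `D`, and `D` preserves the ideal `(t^{n+2})` because `t` divides `D t`. -/
theorem inducedDerivation_linearForm (n : ℕ) {D : W f} (hD : PowerSeries.X ∣ D PowerSeries.X)
    (g : f⟦X⟧) : inducedDerivation f n D (linearForm f n g) = linearForm f n (D g) := by
  obtain ⟨h, hh⟩ : (PowerSeries.X : f⟦X⟧) ^ (n + 2) ∣ g -
      (algebraMap f f⟦X⟧ (PowerSeries.constantCoeff g) + ∑ j ∈ Finset.range (n + 1),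
        PowerSeries.coeff (n - j + 1) g • PowerSeries.X ^ (n - j + 1)) := by
    rw [PowerSeries.X_pow_dvd_iff]
    intro a ha
    rw [map_sub, map_add, map_sum, PowerSeries.algebraMap_apply, Algebra.algebraMap_self_apply,
      PowerSeries.coeff_C, sub_eq_zero]
    rcases a with _ | a
    · rw [if_pos rfl, Finset.sum_eq_zero, add_zero, PowerSeries.coeff_zero_eq_constantCoeff_apply]
      intro j _
      rw [map_smul, PowerSeries.coeff_X_pow, if_neg (by omega), smul_zero]
    · rw [if_neg (by omega), zero_add, Finset.sum_eq_single (n - a)]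
      · rw [map_smul, PowerSeries.coeff_X_pow, if_pos (by omega), smul_eq_mul, mul_one,
          show n - (n - a) = a by omega]
      · intro j hj hja
        rw [Finset.mem_range] at hj
        rw [map_smul, PowerSeries.coeff_X_pow, if_neg (by omega), smul_zero]
      · intro hj
        rw [Finset.mem_range] at hj
        omega
  have h1 : PowerSeries.X ^ (n + 2) ∣ D (PowerSeries.X ^ (n + 2) * h) := by
    obtain ⟨d, hd⟩ := hD
    rw [Derivation.leibniz, Derivation.leibniz_pow, hd, smul_eq_mul, smul_eq_mul]
    refine dvd_add (dvd_mul_right _ _) (dvd_mul_of_dvd_right ?_ _)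
    rw [nsmul_eq_mul, smul_eq_mul, show n + 2 = (n + 1) + 1 by omega, Nat.add_sub_cancel]
    exact ⟨((n + 1 + 1 : ℕ) : f⟦X⟧) * d, by ring⟩
  have h2 : D g = ∑ j ∈ Finset.range (n + 1),
      PowerSeries.coeff (n - j + 1) g • D (PowerSeries.X ^ (n - j + 1)) +
        D (PowerSeries.X ^ (n + 2) * h) := by
    conv_lhs => rw [eq_add_of_sub_eq hh]
    rw [map_add, map_add, Derivation.map_algebraMap, zero_add, map_sum, add_comm]
    simp only [Derivation.map_smul]
  rw [h2, map_add, linearForm_eq_zero h1, add_zero, linearForm_apply, map_sum, map_sum]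
  refine Finset.sum_congr rfl fun j hj => ?_
  rw [Finset.mem_range] at hj
  rw [Derivation.map_smul, map_smul, inducedDerivation_X (by omega)]

theorem inducedDerivation_lie (n : ℕ) {D E : W f} (hD : PowerSeries.X ∣ D PowerSeries.X)
    (hE : PowerSeries.X ∣ E PowerSeries.X) :
    inducedDerivation f n ⁅D, E⁆ = ⁅inducedDerivation f n D, inducedDerivation f n E⁆ := by
  refine derivation_ext fun j => ?_
  rw [Derivation.commutator_apply]
  rcases le_or_gt j n with hj | hj
  · rw [inducedDerivation_X hj, inducedDerivation_X hj, inducedDerivation_X hj,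
      inducedDerivation_linearForm n hD, inducedDerivation_linearForm n hE, ← map_sub,
      Derivation.commutator_apply]
  · rw [inducedDerivation_X_of_lt hj, inducedDerivation_X_of_lt hj, inducedDerivation_X_of_lt hj,
      map_zero, map_zero, sub_zero]

theorem inducedDerivation_add (n : ℕ) (D E : W f) :
    inducedDerivation f n (D + E) = inducedDerivation f n D + inducedDerivation f n E := by
  refine derivation_ext fun j => ?_
  rw [Derivation.add_apply]
  rcases le_or_gt j n with hj | hj
  · simp only [inducedDerivation_X hj, Derivation.add_apply, map_add]
  · simp only [inducedDerivation_X_of_lt hj, add_zero]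

theorem inducedDerivation_smul (n : ℕ) (c : f) (D : W f) :
    inducedDerivation f n (c • D) = c • inducedDerivation f n D := by
  refine derivation_ext fun j => ?_
  rw [Derivation.smul_apply]
  rcases le_or_gt j n with hj | hj
  · simp only [inducedDerivation_X hj, Derivation.smul_apply, map_smul]
  · simp only [inducedDerivation_X_of_lt hj, smul_zero]

variable (f) in
/-- The representation of `L_m` on the polynomial ring in which `D` acts as the sum of the
multiplication by the linear form of `D t` and the induced derivation. -/
def affineRep (m n : ℕ) : L f m →ₗ⁅f⁆ Module.End f (MvPolynomial ℕ f) where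
  toFun D := LinearMap.mulLeft f (linearForm f n ((D : W f) PowerSeries.X)) +
    (inducedDerivation f n (D : W f)).toLinearMap
  map_add' D E := by
    refine LinearMap.ext fun p => ?_
    have h : ((D + E : L f m) : W f) = D + E := rfl
    simp only [h, inducedDerivation_add, LinearMap.add_apply,
      LinearMap.mulLeft_apply, Derivation.coeFn_coe, Derivation.add_apply, map_add]
    ring
  map_smul' c D := by
    refine LinearMap.ext fun p => ?_
    simp [inducedDerivation_smul]
  map_lie' {D E} := by
    have hD : (PowerSeries.X : f⟦X⟧) ∣ (D : W f) PowerSeries.X :=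
      (dvd_pow_self _ m.succ_ne_zero).trans D.2
    have hE : (PowerSeries.X : f⟦X⟧) ∣ (E : W f) PowerSeries.X :=
      (dvd_pow_self _ m.succ_ne_zero).trans E.2
    -- The multiplication part is compatible with brackets because `D ↦ D t` is a cocycle: `[D, E] t
    -- = D (E t) - E (D t)`.
    refine LinearMap.ext fun p => ?_
    rw [LieRing.of_associative_ring_bracket, LieSubalgebra.coe_bracket,
      inducedDerivation_lie n hD hE, Derivation.commutator_apply]
    simp only [LinearMap.add_apply, LinearMap.sub_apply, Module.End.mul_apply,
      LinearMap.mulLeft_apply, Derivation.coeFn_coe, Derivation.commutator_apply, map_add, map_sub,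
      Derivation.leibniz, smul_eq_mul, inducedDerivation_linearForm n hD,
      inducedDerivation_linearForm n hE]
    ring

theorem affineRep_apply (m n : ℕ) (D : L f m) (p : MvPolynomial ℕ f) : affineRep f m n D p =
    linearForm f n ((D : W f) PowerSeries.X) * p + inducedDerivation f n (D : W f) p := rfl

theorem affineRep_eq_zero (m n : ℕ) {D : L f m} (hD : (D : W f) ∈ L f (n + 1)) :
    affineRep f m n D = 0 := by
  have h1 : inducedDerivation f n (D : W f) = 0 := by
    refine derivation_ext fun j => ?_
    rw [Derivation.zero_apply]
    rcases le_or_gt j n with hj | hj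
    · rw [inducedDerivation_X hj]
      exact linearForm_eq_zero (X_pow_dvd_apply hD _)
    · exact inducedDerivation_X_of_lt hj _
  refine LinearMap.ext fun p => ?_
  rw [affineRep_apply, h1, linearForm_eq_zero hD]
  simp

variable (f) in
/-- The representation of `L_m / L_{n+1}` induced by `affineRep`. -/
def affineRepQuot (m n : ℕ) : LQuot f m (n + 1) →ₗ⁅f⁆ Module.End f (MvPolynomial ℕ f) where
  toLinearMap := (LIdeal f m (n + 1)).toSubmodule.liftQ (affineRep f m n : L f m →ₗ[f] _)
    fun _ hD => LinearMap.mem_ker.mpr (affineRep_eq_zero m n hD)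
  map_lie' {D E} := by
    induction D using Submodule.Quotient.induction_on with | _ D
    induction E using Submodule.Quotient.induction_on with | _ E
    exact (affineRep f m n).map_lie D E

theorem lift_affineRepQuot_l {m n i : ℕ} (h : m ≤ i) (hi : i ≤ n) (p : MvPolynomial ℕ f) :
    UniversalEnvelopingAlgebra.lift f (affineRepQuot f m n) (l f m (n + 1) h) p =
      X (n - i) * p + inducedDerivation f n (vectorField f i) p := by
  rw [l, UniversalEnvelopingAlgebra.lift_ι_apply]
  change linearForm f n (vectorField f i PowerSeries.X) * p + _ = _
  rw [vectorField, Derivation.smul_apply, PowerSeries.derivative_X, smul_eq_mul, mul_one]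
  have := linearForm_X_pow (f := f) (n := n) (j := n - i) (by omega)
  rw [show n - (n - i) = i by omega] at this
  rw [this]
  rfl

end Representation

/-! ### Generators and relations of the enveloping algebra -/

section Generators

variable {f : Type*} [Field f]

theorem lie_vectorField (i j : ℕ) :
    ⁅vectorField f i, vectorField f j⁆ = ((j : f) - i) • vectorField f (i + j) := by
  ext1 g
  have hp (k : ℕ) : PowerSeries.derivative f ((PowerSeries.X : f⟦X⟧) ^ (k + 1)) =
      (k + 1 : f⟦X⟧) * PowerSeries.X ^ k := by
    rw [Derivation.leibniz_pow, PowerSeries.derivative_X, Nat.add_sub_cancel, smul_eq_mul, mul_one,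
      nsmul_eq_mul]
    push_cast; rfl
  have hc : ((j : f) - i) • (PowerSeries.X ^ (i + j + 1) * PowerSeries.derivative f g) =
      ((j : f⟦X⟧) - (i : f⟦X⟧)) * (PowerSeries.X ^ (i + j + 1) * PowerSeries.derivative f g) := by
    rw [Algebra.smul_def, map_sub, map_natCast, map_natCast]
  simp only [vectorField, Derivation.commutator_apply, Derivation.smul_apply, Derivation.leibniz,
    hp, smul_eq_mul]
  rw [hc]
  ring

theorem l_mul_l_sub {m i j : ℕ} (n : ℕ) (hi : m ≤ i) (hj : m ≤ j) :
    l f m n hi * l f m n hj - l f m n hj * l f m n hi =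
      ((j : f) - i) • l f m n (hi.trans (Nat.le_add_right i j)) := by
  rw [l, l, l, ← LieRing.of_associative_ring_bracket, ← LieHom.map_lie, ← map_smul,
    ← LieSubmodule.Quotient.mk_bracket]
  congr 1
  rw [← Submodule.Quotient.mk_smul]
  congr 1
  exact Subtype.ext (lie_vectorField i j)

theorem l_eq_zero {m n i : ℕ} (h : m ≤ i) (hi : n ≤ i) : l f m n h = 0 := by
  rw [l, LieSubmodule.Quotient.mk_eq_zero'.mpr, map_zero]
  exact vectorField_mem f hi

variable (f) in
/-- The elements `y_j = l_{n-j}` of the universal enveloping algebra of `L_m / L_{n+1}`,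
completed by `0` for `n - j < m`. -/
def generator (m n j : ℕ) : U f m (n + 1) :=
  if h : m ≤ n - j then l f m (n + 1) h else 0

theorem generator_eq {m n j : ℕ} (h : m ≤ n - j) : generator f m n j = l f m (n + 1) h :=
  dif_pos h

/-- The reversed index turns `l_{2n-i-j}` into `y_{i+j-n}`; for `i + j < n` its index exceeds `n`,
so it is zero in the quotient. -/
theorem wittRelations_generator (m n : ℕ) :
    WittRelations f (generator f (m + 1) n) n (n - m) where
  le := Nat.sub_le n m
  mul_comm_add i hi j hj := by
    rw [generator_eq (by omega : m + 1 ≤ n - i), generator_eq (by omega : m + 1 ≤ n - j),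
      ← sub_eq_iff_eq_add', l_mul_l_sub, Nat.cast_sub (by omega), Nat.cast_sub (by omega),
      sub_sub_sub_cancel_left]
    split_ifs with h
    · rw [generator_eq (by omega : m + 1 ≤ n - (i + j - n))]
      congr 2
      omega
    · rw [l_eq_zero _ (by omega), smul_zero]

/-- The universal property gives a map into the generated subalgebra `B`; followed by the inclusion
it fixes the image of `ι`, hence is the identity. -/
theorem adjoin_range_ι {R L : Type*} [CommRing R] [LieRing L] [LieAlgebra R L] :
    Algebra.adjoin R (Set.range (UniversalEnvelopingAlgebra.ι R : L → _)) = ⊤ := by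
  set B := Algebra.adjoin R (Set.range (UniversalEnvelopingAlgebra.ι R : L → _))
  let φ : L →ₗ⁅R⁆ B :=
    { toFun := fun D => ⟨UniversalEnvelopingAlgebra.ι R D, Algebra.subset_adjoin ⟨D, rfl⟩⟩
      map_add' := fun D E => Subtype.ext (map_add _ D E)
      map_smul' := fun c D => Subtype.ext (map_smul _ c D)
      map_lie' := fun {D E} => Subtype.ext (LieHom.map_lie _ D E) }
  have h : B.val.comp (UniversalEnvelopingAlgebra.lift R φ) = AlgHom.id R _ := by
    refine UniversalEnvelopingAlgebra.hom_ext R (LieHom.ext fun D => ?_)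
    change (UniversalEnvelopingAlgebra.lift R φ (UniversalEnvelopingAlgebra.ι R D) : _) =
      UniversalEnvelopingAlgebra.ι R D
    rw [UniversalEnvelopingAlgebra.lift_ι_apply]
    rfl
  rw [eq_top_iff]
  intro u _
  have := congrArg (fun ψ => ψ u) h
  change (UniversalEnvelopingAlgebra.lift R φ u : _) = u at this
  rw [← this]
  exact (UniversalEnvelopingAlgebra.lift R φ u).2

theorem X_pow_dvd_sub_sum {m n : ℕ} {g : f⟦X⟧} (hg : PowerSeries.X ^ (m + 2) ∣ g) :
    PowerSeries.X ^ (n + 2) ∣ g - ∑ j : Fin (n - m),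
      PowerSeries.coeff (n - j + 1) g • PowerSeries.X ^ (n - j + 1) := by
  rw [PowerSeries.X_pow_dvd_iff]
  intro a ha
  rw [map_sub, map_sum, sub_eq_zero]
  simp only [map_smul, PowerSeries.coeff_X_pow]
  rcases lt_or_ge a (m + 2) with h | h
  · rw [PowerSeries.X_pow_dvd_iff.mp hg a h, Finset.sum_eq_zero]
    intro j _
    rw [if_neg (by omega), smul_zero]
  · rw [Finset.sum_eq_single ⟨n + 1 - a, by omega⟩]
    · rw [if_pos (by simp; omega), smul_eq_mul, mul_one]
      congr 2
      simp; omega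
    · intro j _ hj
      rw [if_neg (fun h' => hj (Fin.ext (by simp; omega))), smul_zero]
    · exact fun h' => absurd (Finset.mem_univ _) h'

theorem adjoin_generator (m n : ℕ) :
    Algebra.adjoin f (generator f (m + 1) n '' {j | j < n - m}) = ⊤ := by
  rw [eq_top_iff, ← adjoin_range_ι, Algebra.adjoin_le_iff]
  rintro _ ⟨D, rfl⟩
  induction D using Submodule.Quotient.induction_on with | _ D
  have hlt (j : Fin (n - m)) : m + 1 ≤ n - j := by omega
  set c : Fin (n - m) → f := fun j => PowerSeries.coeff (n - j + 1) ((D : W f) PowerSeries.X)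
  set E : L f (m + 1) := ∑ j, c j • lSub f (hlt j) with hE
  have h1 : D - E ∈ LIdeal f (m + 1) (n + 1) := by
    change PowerSeries.X ^ (n + 1 + 1) ∣ (((D - E : L f (m + 1)) : W f)) PowerSeries.X
    have h2 : ((D - E : L f (m + 1)) : W f) PowerSeries.X = (D : W f) PowerSeries.X -
        ∑ j : Fin (n - m), c j • PowerSeries.X ^ (n - j + 1) := by
      have h3 : (E : W f) = ∑ j : Fin (n - m), c j • vectorField f (n - j) := by
        rw [hE, AddSubmonoidClass.coe_finsetSum]
        rfl
      rw [AddSubgroupClass.coe_sub, Derivation.sub_apply, h3]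
      congr 1
      have h4 : ∀ S : Finset (Fin (n - m)), (∑ j ∈ S, c j • vectorField f (n - j)) PowerSeries.X =
          ∑ j ∈ S, c j • (PowerSeries.X : f⟦X⟧) ^ (n - j + 1) := by
        intro S
        induction S using Finset.induction_on with
        | empty => simp
        | insert j S hj ih =>
          rw [Finset.sum_insert hj, Finset.sum_insert hj, Derivation.add_apply, ih,
            Derivation.smul_apply, vectorField, Derivation.smul_apply, PowerSeries.derivative_X,
            smul_eq_mul, mul_one]
      exact h4 _
    rw [h2]
    exact X_pow_dvd_sub_sum D.2
  have h5 : (Submodule.Quotient.mk D : LQuot f (m + 1) (n + 1)) =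
      LieSubmodule.Quotient.mk' (LIdeal f (m + 1) (n + 1)) E :=
    (Submodule.Quotient.eq _).mpr h1
  rw [h5, hE, map_sum, map_sum]
  refine sum_mem fun j _ => ?_
  rw [map_smul, map_smul]
  refine Subalgebra.smul_mem _ (Algebra.subset_adjoin (show _ ∈ _ '' _ from
    ⟨(j : ℕ), j.2, generator_eq (hlt j)⟩)) _

theorem generator_injective (m n : ℕ) {g : MvPolynomial ℕ f}
    (hg : g ∈ supported f {j | j < n - m})
    (h : orderedEval f (generator f (m + 1) n) (n - m) g = 0) : g = 0 := by
  refine eq_zero_of_orderedEval_eq_zero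
    (T := UniversalEnvelopingAlgebra.lift f (affineRepQuot f (m + 1) n))
    (D := fun j => inducedDerivation f n (vectorField f (n - j))) (fun j k => ?_)
    (fun j hj p => ?_) hg h
  · rcases le_or_gt k n with hk | hk
    · rw [inducedDerivation_X hk]
      exact linearForm_mem_degreeLT _ _
    · rw [inducedDerivation_X_of_lt hk]
      exact zero_mem _
  · rw [generator_eq (by omega : m + 1 ≤ n - j), lift_affineRepQuot_l _ (by omega),
      show n - (n - j) = j by omega]

theorem mul_comm_of_le (m n : ℕ) (hn : n ≤ 2 * m + 2) (a b : U f (m + 1) (n + 1)) :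
    a * b = b * a := by
  have h (j : ℕ) (hj : j < n - m) : generator f (m + 1) n j ∈ Subalgebra.center f _ :=
    -- With `i, j ≤ n - m - 1` and `n ≤ 2m + 2`, `i + j ≥ n` is possible only for `i = j`.
    mem_center_of_commute (adjoin_generator m n) fun i hi =>
      (wittRelations_generator m n).commute hi hj (by omega)
  have h1 : (⊤ : Subalgebra f (U f (m + 1) (n + 1))) ≤ Subalgebra.center f _ := by
    rw [← adjoin_generator m n, Algebra.adjoin_le_iff]
    rintro _ ⟨j, hj, rfl⟩
    exact h j hj
  exact Subalgebra.mem_center_iff.mp (h1 (Algebra.mem_top : b ∈ ⊤)) a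

theorem evalAt_eq_orderedEval {A : Type*} [Ring A] [Algebra f A] {q N : ℕ} (hq : q ≤ N)
    (y : ℕ → A) (P : MvPolynomial (Fin q) f) :
    evalAt (fun j : Fin q => y j) P = orderedEval f y N (rename Fin.val P) := by
  conv_rhs => rw [P.as_sum, map_sum, map_sum]
  refine Finset.sum_congr rfl fun s _ => ?_
  rw [rename_monomial, orderedEval_monomial, orderedWord_eq_of_le y hq, orderedWord]
  · congr 2
    rw [← List.map_coe_finRange_eq_range, List.map_map, List.ofFn_eq_map]
    refine List.map_congr_left fun j _ => ?_
    rw [Function.comp_apply, Finsupp.mapDomain_apply Fin.val_injective]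
  · intro j hj
    refine Finsupp.mapDomain_of_notMem_range _ _ ?_
    rintro ⟨i, rfl⟩
    omega

end Generators

end WittType

end

/-! ### Assembly of the three statements -/

theorem theorem1 {f : Type*} [Field f] [CharZero f] (m : ℕ) :
    (∀ n : ℕ, n ≤ 2 * m + 2 → ∀ a b : WittType.U f (m + 1) (n + 1), a * b = b * a) ∧
    (∀ (n : ℕ) (_hn : 2 * m + 2 ≤ n), Odd n →
      WittType.CenterIsPolynomialAlgebra f
        (fun j : Fin (m + 1) =>
          WittType.l f (m + 1) (n + 1) (i := n - j) (by have := j.isLt; omega))) ∧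
    (∃ P : (k : ℕ) → MvPolynomial (Fin (m + k + 1)) f,
      WittType.HasGeneratingFunction m P ∧
      ∀ (n : ℕ) (_hn : 2 * m + 2 ≤ n), Even n → ∀ (k : ℕ) (_hk : k = n / 2 - m),
        WittType.CenterIsPolynomialAlgebra f
          (Fin.snoc (α := fun _ : Fin (m + 2) => WittType.U f (m + 1) (n + 1))
            (fun j : Fin (m + 1) =>
              WittType.l f (m + 1) (n + 1) (i := n - j) (by have := j.isLt; omega))
            (WittType.evalAt
              (fun j : Fin (m + k + 1) =>
                WittType.l f (m + 1) (n + 1) (i := n - j) (by have := j.isLt; omega))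
              (P k)))) := by
  obtain ⟨Q, hQs, ⟨s, r, hs, hr, hsr⟩, hQ⟩ := WittType.exists_generating_polynomials (f := f) m
  choose P hP using fun k => WittType.exists_rename_eq (hQs k)
  refine ⟨fun n hn => WittType.mul_comm_of_le m n hn, fun n hn hodd => ?_, P,
    ⟨_, _, hs, hr, ?_⟩, fun n hn heven k hk => ?_⟩
  · have h := (WittType.wittRelations_generator (f := f) m n).centerIsPolynomialAlgebra_of_odd hn
      hodd (WittType.adjoin_generator m n) fun g hg => WittType.generator_injective m n hg
    convert h using 2 with j
    exact (WittType.generator_eq _).symm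
  -- The generating identity holds over `f[x_0, x_1, …]` and is carried to the fraction field
  -- coefficientwise.
  · rw [← map_sub, ← hsr, map_mul, map_mul, map_pow (PowerSeries.map _) PowerSeries.X,
      PowerSeries.map_X, PowerSeries.map_C, map_pow (algebraMap _ _)]
    congr 1
    ext1 k
    rw [PowerSeries.coeff_map, PowerSeries.coeff_mk, PowerSeries.coeff_mk, hP]
    split_ifs
    · rw [map_zero]
    · rfl
  · obtain ⟨h, rfl⟩ := heven
    have hk1 : 1 ≤ k := by omega
    have hmk : h + h = 2 * (m + k) := by omega
    obtain ⟨h1, h2, h3⟩ := hQ k hk1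
    have H := (WittType.wittRelations_generator (f := f) m (h + h)).centerIsPolynomialAlgebra_of_even
      hk1 hmk (WittType.adjoin_generator m (h + h))
      (fun g hg => WittType.generator_injective m (h + h) hg) (hQs k) h1 h2
      fun i hi hik => by rw [WittType.shiftDerivation_apply]; exact h3 i hi hik
    rw [← hP k, ← WittType.evalAt_eq_orderedEval (by omega)] at H
    convert H using 2
    · funext j
      exact (WittType.generator_eq _).symm
    · congr 1
      funext j
      exact (WittType.generator_eq _).symm
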